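/- **Theorem 3.1.** Let $0\le m\le n$ and $l$ be integers and $0\le\alpha<s<\beta\le T$. Let $A(t)$ be an $n\times n$ matrix continuous on $[0,T]$, $H(t)$ an $l\times n$ matrix continuous on $[\alpha,\beta]$, $B_0$ and $B_1$ real $m\times n$ and $(n-m)\times n$ matrices of rank $m$ and $n-m$, and $a\in\mathbb R^n$. Here $H^1(c,d)$ is the space of absolutely continuous functions on $[c,d]$ with derivative in $L^2(c,d)$, differential equations hold almost everywhere, $(\cdot,\cdot)$ is the Euclidean inner product, $M$ is expectation, and $L=\frac{d}{dt}+A$, $L^*=-\frac{d}{dt}+A^T$. Assume that the problem $L\varphi=0$ on $(0,T)$, $B_0\varphi(0)=0$, $B_1\varphi(T)=0$ has only the trivial solution in $H^1(0,T)^n$. Choose a nondegenerate $m\times m$ submatrix $B_{01}$ of $B_0$ formed by $m$ of its columns, and let $B_{02}$ consist of the remaining columns. Put $\hat B_0=(-B_{02}^T(B_{01}^T)^{-1},E_{n-m})$ and $\bar B_0=((B_{01}^T)^{-1},O_{m,n-m})$, where the columns of the first and of the second block are placed at the positions in $B_0$ of the columns of $B_{01}$ and of $B_{02}$, respectively. Define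 $\hat B_1$ ($m\times n$) and $\bar B_1$ ($(n-m)\times n$) in the same way from a nondegenerate $(n-m)\times(n-m)$ submatrix $B_{11}$ of $B_1$ formed by $n-m$ of its columns and the matrix $B_{12}$ of the remaining columns. Let $Q_0$, $Q_1$, $Q(t)$, $Q_2(t)$ be symmetric positive definite matrices of sizes $m$, $n-m$, $l$, $n$, with $Q$ continuous on $[\alpha,\beta]$ and $Q_2$ continuous on $[0,T]$, and let $f_0^{(0)}\in\mathbb R^m$, $f_1^{(0)}\in\mathbb R^{n-m}$, $f^{(0)}\in L^2(0,T)^n$. Let $G$ be the set of all $(f_0,f_1,f)\in\mathbb R^m\times\mathbb R^{n-m}\times L^2(0,T)^n$ with $$(Q_0(f_0-f_0^{(0)}),f_0-f_0^{(0)})+(Q_1(f_1-f_1^{(0)}),f_1-f_1^{(0)})+\int_0^T(Q_2(t)(f(t)-f^{(0)}(t)),f(t)-f^{(0)}(t))\,dt\le 1 .$$ On a probability space that has an event of probability different from $0$ and $1$, let $V$ be the set of measurable random processes $\xi(t)$ on $(\alpha,\beta)$ with values in $\mathbb R^l$, with finite second moments and $M\xi(t)=0$ for every $t\in(\alpha,\beta)$,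 with $M|\xi(t)|^2$ integrable on $(\alpha,\beta)$, and with $\int_\alpha^\beta \mathrm{Sp}\,[Q(t)R(t,t)]\,dt\le 1$, where $R(t,t')=M\xi(t)\xi(t')^T$ and $\mathrm{Sp}$ is the trace. For $(f_0,f_1,f)\in G$ let $\varphi\in H^1(0,T)^n$ be the solution of $L\varphi=f$ on $(0,T)$, $B_0\varphi(0)=f_0$, $B_1\varphi(T)=f_1$, and for $\xi\in V$ let $y(t)=H(t)\varphi(t)+\xi(t)$ be observed on $(\alpha,\beta)$. For $u=(u_1,u_2)\in L^2(\alpha,s)^l\times L^2(s,\beta)^l$ and $c\in\mathbb R$ put $$\sigma(u,c)=\sup_{(f_0,f_1,f)\in G,\ \xi\in V} M\Big|(a,\varphi(s))-\int_\alpha^s(u_1(t),y(t))\,dt-\int_s^\beta(u_2(t),y(t))\,dt-c\Big|^2,\qquad \sigma^2=\inf_{u,c}\sigma(u,c).$$ A linear estimate $\int_\alpha^s(u_1,y)\,dt+\int_s^\beta(u_2,y)\,dt+c$ of $(a,\varphi(s))$ is called minimax if $\sigma(u,c)=\sigma^2$, and $\sigma\ge 0$ is called the minimax estimation error. Then the system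 $$\begin{aligned} L^*z_1&=0 \text{ on } (0,\alpha), & \hat B_0z_1(0)&=0,\\ L^*z_2&=-H^TQHp_2 \text{ on } (\alpha,s), & z_2(\alpha)&=z_1(\alpha),\\ L^*z_3&=-H^TQHp_3 \text{ on } (s,\beta), & z_3(s)&=z_2(s)-a,\\ L^*z_4&=0 \text{ on } (\beta,T), & z_4(\beta)&=z_3(\beta),\quad \hat B_1z_4(T)=0,\\ Lp_1&=Q_2^{-1}z_1 \text{ on } (0,\alpha), & B_0p_1(0)&=Q_0^{-1}\bar B_0z_1(0),\\ Lp_2&=Q_2^{-1}z_2 \text{ on } (\alpha,s), & p_2(\alpha)&=p_1(\alpha),\\ Lp_3&=Q_2^{-1}z_3 \text{ on } (s,\beta), & p_3(s)&=p_2(s),\\ Lp_4&=Q_2^{-1}z_4 \text{ on } (\beta,T), & p_4(\beta)&=p_3(\beta),\quad B_1p_4(T)=-Q_1^{-1}\bar B_1z_4(T) \end{aligned}$$ has exactly one solution with $z_1,p_1\in H^1(0,\alpha)^n$, $z_2,p_2\in H^1(\alpha,s)^n$, $z_3,p_3\in H^1(s,\beta)^n$, $z_4,p_4\in H^1(\beta,T)^n$.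 There is exactly one minimax estimate of $(a,\varphi(s))$ (with $u_1,u_2$ determined up to null sets), namely $$\int_\alpha^s(\hat u_1(t),y(t))\,dt+\int_s^\beta(\hat u_2(t),y(t))\,dt+\hat c,\qquad \hat u_1=QHp_2,\quad \hat u_2=QHp_3,$$ $$\hat c=(\bar B_0z_1(0),f_0^{(0)})-(\bar B_1z_4(T),f_1^{(0)})+\int_0^T(\tilde z(t),f^{(0)}(t))\,dt,$$ where $\tilde z$ equals $z_1,z_2,z_3,z_4$ on $(0,\alpha),(\alpha,s),(s,\beta),(\beta,T)$, respectively. The minimax estimation error is $\sigma=(a,p_2(s))^{1/2}$; in particular $(a,p_2(s))\ge 0$. If $\alpha=0$ (or $\beta=T$), the functions on the empty interval are to be read as their values at the single point $0$ (or $T$). -/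

import Mathlib

open MeasureTheory Set
open scoped Matrix ENNReal

namespace TwoPoint

noncomputable section

/-- The scalar space `H¹(a, b)`: absolutely continuous on `[a, b]`, with derivative (which then
exists almost everywhere) in `L²(a, b)`. -/
def IsH1 (a b : ℝ) (g : ℝ → ℝ) : Prop :=
  AbsolutelyContinuousOnInterval g a b ∧ MemLp (deriv g) 2 (volume.restrict (Ioo a b))

/-- `φ ∈ H¹(a, b)ⁿ` solves `Lφ = dφ/dt + Aφ = g` almost everywhere on `(a, b)`. -/
def SolvesDirect {n : ℕ} (A : ℝ → Matrix (Fin n) (Fin n) ℝ) (a b : ℝ) (g φ : ℝ → Fin n → ℝ) :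
    Prop :=
  (∀ i, IsH1 a b (fun t => φ t i)) ∧
    ∀ᵐ t ∂(volume.restrict (Ioo a b)), HasDerivAt φ (g t - A t *ᵥ φ t) t

/-- `ψ ∈ H¹(a, b)ⁿ` solves `L*ψ = -dψ/dt + Aᵀψ = g` almost everywhere on `(a, b)`. -/
def SolvesAdjoint {n : ℕ} (A : ℝ → Matrix (Fin n) (Fin n) ℝ) (a b : ℝ) (g ψ : ℝ → Fin n → ℝ) :
    Prop :=
  (∀ i, IsH1 a b (fun t => ψ t i)) ∧
    ∀ᵐ t ∂(volume.restrict (Ioo a b)), HasDerivAt ψ ((A t)ᵀ *ᵥ ψ t - g t) t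

section Boundary

variable {μ ν ι : Type*} [Fintype μ] [DecidableEq μ] [DecidableEq ν]

/-- A splitting `e : μ ⊕ ν ≃ ι` of the columns of `B` selects the square submatrix made of the
columns `e (inl k)`. -/
def selectedCols (e : μ ⊕ ν ≃ ι) (B : Matrix μ ι ℝ) : Matrix μ μ ℝ :=
  B.submatrix id (fun k => e (Sum.inl k))

/-- The remaining columns `e (inr l)` of `B`. -/
def remainingCols (e : μ ⊕ ν ≃ ι) (B : Matrix μ ι ℝ) : Matrix μ ν ℝ :=
  B.submatrix id (fun l => e (Sum.inr l))

/-- The matrix `B̂ = (-B₂ᵀ (B₁ᵀ)⁻¹, E)`, its columns placed according to the splitting `e`, where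
`B₁` and `B₂` consist of the selected and of the remaining columns of `B`. -/
def hatMatrix (e : μ ⊕ ν ≃ ι) (B : Matrix μ ι ℝ) : Matrix ν ι ℝ :=
  (Matrix.fromCols (-((remainingCols e B)ᵀ * ((selectedCols e B)ᵀ)⁻¹)) (1 : Matrix ν ν ℝ)).submatrix
    id e.symm

/-- The matrix `B̄ = ((B₁ᵀ)⁻¹, O)`, its columns placed according to the splitting `e`. -/
def barMatrix (e : μ ⊕ ν ≃ ι) (B : Matrix μ ι ℝ) : Matrix μ ι ℝ :=
  (Matrix.fromCols (((selectedCols e B)ᵀ)⁻¹) (0 : Matrix μ ν ℝ)).submatrix id e.symm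

end Boundary

/-- The raw data of the estimation problem (without any assumption on them): state dimension `n`,
`m` conditions at `0` and `n - m` conditions at `T`, observations in `ℝˡ` on `(α, β)`. -/
structure Data (n m l : ℕ) where
  /-- right end of the interval `(0, T)` -/
  T : ℝ
  /-- the observation interval is `(α, β)` -/
  α : ℝ
  /-- the observation interval is `(α, β)` -/
  β : ℝ
  /-- the point at which the solution is estimated -/
  s : ℝ
  /-- the vector defining the functional `(a, φ(s))` -/
  a : Fin n → ℝ
  /-- coefficient of the differential equation -/
  A : ℝ → Matrix (Fin n) (Fin n) ℝ
  /-- boundary matrix at `0` -/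
  B₀ : Matrix (Fin m) (Fin n) ℝ
  /-- boundary matrix at `T` -/
  B₁ : Matrix (Fin (n - m)) (Fin n) ℝ
  /-- splitting of the columns of `B₀`: `i_k = e₀ (inl k)`, `j_l = e₀ (inr l)` -/
  e₀ : Fin m ⊕ Fin (n - m) ≃ Fin n
  /-- splitting of the columns of `B₁`: `i'_k = e₁ (inl k)`, `j'_l = e₁ (inr l)` -/
  e₁ : Fin (n - m) ⊕ Fin m ≃ Fin n
  /-- observation matrix -/
  H : ℝ → Matrix (Fin l) (Fin n) ℝ
  /-- weight in the restriction on the noise -/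
  Q : ℝ → Matrix (Fin l) (Fin l) ℝ
  /-- weight of the boundary data at `0` -/
  Q₀ : Matrix (Fin m) (Fin m) ℝ
  /-- weight of the boundary data at `T` -/
  Q₁ : Matrix (Fin (n - m)) (Fin (n - m)) ℝ
  /-- weight of the right-hand side -/
  Q₂ : ℝ → Matrix (Fin n) (Fin n) ℝ
  /-- centre of the ellipsoid, boundary data at `0` -/
  f₀c : Fin m → ℝ
  /-- centre of the ellipsoid, boundary data at `T` -/
  f₁c : Fin (n - m) → ℝ
  /-- centre of the ellipsoid, right-hand side -/
  fc : ℝ → Fin n → ℝ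

namespace Data

variable {n m l : ℕ} (D : Data n m l)

/-- `φ` solves `Lφ = f` on `(0, T)`, `B₀ φ(0) = f₀`, `B₁ φ(T) = f₁`. -/
def SolvesBVP (f₀ : Fin m → ℝ) (f₁ : Fin (n - m) → ℝ) (f φ : ℝ → Fin n → ℝ) : Prop :=
  SolvesDirect D.A 0 D.T f φ ∧ D.B₀ *ᵥ φ 0 = f₀ ∧ D.B₁ *ᵥ φ D.T = f₁

/-- Membership of `(f₀, f₁, f)` in the ellipsoid `G`. -/
def InG (f₀ : Fin m → ℝ) (f₁ : Fin (n - m) → ℝ) (f : ℝ → Fin n → ℝ) : Prop :=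
  MemLp f 2 (volume.restrict (Ioo 0 D.T)) ∧
    (D.Q₀ *ᵥ (f₀ - D.f₀c)) ⬝ᵥ (f₀ - D.f₀c) + (D.Q₁ *ᵥ (f₁ - D.f₁c)) ⬝ᵥ (f₁ - D.f₁c)
      + ∫ t in (0 : ℝ)..D.T, (D.Q₂ t *ᵥ (f t - D.fc t)) ⬝ᵥ (f t - D.fc t) ≤ 1

variable {Ω : Type*} [MeasurableSpace Ω] (P : Measure Ω)

/-- The correlation matrix `R(t, t') = M ξ(t) ξ(t')ᵀ` of a centred random process. -/
def correlation (ξ : ℝ → Ω → Fin l → ℝ) (t t' : ℝ) : Matrix (Fin l) (Fin l) ℝ :=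
  Matrix.of fun i j => ∫ ω, ξ t ω i * ξ t' ω j ∂P

/-- Membership in the set `V` of (measurable) random processes on `(α, β)` with zero expectation,
second moments integrable over `(α, β)`, and `∫_α^β Sp [Q(t) R(t, t)] dt ≤ 1`. -/
def InV (ξ : ℝ → Ω → Fin l → ℝ) : Prop :=
  Measurable (Function.uncurry ξ) ∧
    (∀ t ∈ Ioo D.α D.β, MemLp (ξ t) 2 P ∧ ∫ ω, ξ t ω ∂P = 0) ∧
    IntegrableOn (fun t => ∫ ω, ξ t ω ⬝ᵥ ξ t ω ∂P) (Ioo D.α D.β) ∧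
    ∫ t in D.α..D.β, (D.Q t * correlation P ξ t t).trace ≤ 1

/-- The linear estimate `∫_α^s (u₁, y) dt + ∫_s^β (u₂, y) dt + c` from an observation `y`. -/
def estimate (u₁ u₂ : ℝ → Fin l → ℝ) (c : ℝ) (y : ℝ → Fin l → ℝ) : ℝ :=
  (∫ t in D.α..D.s, u₁ t ⬝ᵥ y t) + (∫ t in D.s..D.β, u₂ t ⬝ᵥ y t) + c

/-- The largest mean square error
`sup { M |(a, φ(s)) - estimate(Hφ + ξ)|² : (f₀, f₁, f) ∈ G, ξ ∈ V }` of a linear estimate, where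
`φ` is the solution of the boundary value problem with data `(f₀, f₁, f)`. -/
def worstError (u₁ u₂ : ℝ → Fin l → ℝ) (c : ℝ) : ℝ≥0∞ :=
  ⨆ (f₀ : Fin m → ℝ) (f₁ : Fin (n - m) → ℝ) (f : ℝ → Fin n → ℝ) (_ : D.InG f₀ f₁ f)
    (φ : ℝ → Fin n → ℝ) (_ : D.SolvesBVP f₀ f₁ f φ)
    (ξ : ℝ → Ω → Fin l → ℝ) (_ : D.InV P ξ),
    ∫⁻ ω, ENNReal.ofReal
      ((D.a ⬝ᵥ φ D.s - D.estimate u₁ u₂ c (fun t => D.H t *ᵥ φ t + ξ t ω)) ^ 2) ∂P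

/-- Admissible weights: `u₁ ∈ L²(α, s)`, `u₂ ∈ L²(s, β)`. -/
def Admissible (u₁ u₂ : ℝ → Fin l → ℝ) : Prop :=
  MemLp u₁ 2 (volume.restrict (Ioo D.α D.s)) ∧ MemLp u₂ 2 (volume.restrict (Ioo D.s D.β))

/-- The infimum `σ²` of the largest mean square error over all linear estimates. -/
def minimaxValue : ℝ≥0∞ :=
  ⨅ (u₁ : ℝ → Fin l → ℝ) (u₂ : ℝ → Fin l → ℝ) (_ : D.Admissible u₁ u₂) (c : ℝ),
    D.worstError P u₁ u₂ c

/-- The linear estimate given by `(u₁, u₂, c)` is a minimax estimate. -/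
def IsMinimax (u₁ u₂ : ℝ → Fin l → ℝ) (c : ℝ) : Prop :=
  D.Admissible u₁ u₂ ∧ D.worstError P u₁ u₂ c = D.minimaxValue P

/-- The minimax estimation error `σ`. -/
def minimaxError : ℝ≥0∞ := D.minimaxValue P ^ (1 / 2 : ℝ)

end Data

/-- Eight vector functions `zᵢ`, `pᵢ`, `i = 1, …, 4`, the unknowns of the coupled system. -/
structure Pieces (n : ℕ) where
  z₁ : ℝ → Fin n → ℝ
  z₂ : ℝ → Fin n → ℝ
  z₃ : ℝ → Fin n → ℝ
  z₄ : ℝ → Fin n → ℝ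
  p₁ : ℝ → Fin n → ℝ
  p₂ : ℝ → Fin n → ℝ
  p₃ : ℝ → Fin n → ℝ
  p₄ : ℝ → Fin n → ℝ

namespace Data

variable {n m l : ℕ} (D : Data n m l)

/-- The matrix `B̂₀`. -/
def B₀hat : Matrix (Fin (n - m)) (Fin n) ℝ := hatMatrix D.e₀ D.B₀

/-- The matrix `B̄₀`. -/
def B₀bar : Matrix (Fin m) (Fin n) ℝ := barMatrix D.e₀ D.B₀

/-- The matrix `B̂₁`. -/
def B₁hat : Matrix (Fin m) (Fin n) ℝ := hatMatrix D.e₁ D.B₁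

/-- The matrix `B̄₁`. -/
def B₁bar : Matrix (Fin (n - m)) (Fin n) ℝ := barMatrix D.e₁ D.B₁

/-- The coupled adjoint / direct system for `zᵢ, pᵢ` on `(0, α)`, `(α, s)`, `(s, β)`, `(β, T)`. -/
structure SolvesSystem (w : Pieces n) : Prop where
  z₁_eq : SolvesAdjoint D.A 0 D.α (fun _ => 0) w.z₁
  z₁_zero : D.B₀hat *ᵥ w.z₁ 0 = 0
  z₂_eq : SolvesAdjoint D.A D.α D.s
    (fun t => -((D.H t)ᵀ *ᵥ (D.Q t *ᵥ (D.H t *ᵥ w.p₂ t)))) w.z₂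
  z₂_left : w.z₂ D.α = w.z₁ D.α
  z₃_eq : SolvesAdjoint D.A D.s D.β
    (fun t => -((D.H t)ᵀ *ᵥ (D.Q t *ᵥ (D.H t *ᵥ w.p₃ t)))) w.z₃
  z₃_left : w.z₃ D.s = w.z₂ D.s - D.a
  z₄_eq : SolvesAdjoint D.A D.β D.T (fun _ => 0) w.z₄
  z₄_left : w.z₄ D.β = w.z₃ D.β
  z₄_end : D.B₁hat *ᵥ w.z₄ D.T = 0
  p₁_eq : SolvesDirect D.A 0 D.α (fun t => (D.Q₂ t)⁻¹ *ᵥ w.z₁ t) w.p₁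
  p₁_zero : D.B₀ *ᵥ w.p₁ 0 = D.Q₀⁻¹ *ᵥ (D.B₀bar *ᵥ w.z₁ 0)
  p₂_eq : SolvesDirect D.A D.α D.s (fun t => (D.Q₂ t)⁻¹ *ᵥ w.z₂ t) w.p₂
  p₂_left : w.p₂ D.α = w.p₁ D.α
  p₃_eq : SolvesDirect D.A D.s D.β (fun t => (D.Q₂ t)⁻¹ *ᵥ w.z₃ t) w.p₃
  p₃_left : w.p₃ D.s = w.p₂ D.s
  p₄_eq : SolvesDirect D.A D.β D.T (fun t => (D.Q₂ t)⁻¹ *ᵥ w.z₄ t) w.p₄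
  p₄_left : w.p₄ D.β = w.p₃ D.β
  p₄_end : D.B₁ *ᵥ w.p₄ D.T = -(D.Q₁⁻¹ *ᵥ (D.B₁bar *ᵥ w.z₄ D.T))

/-- Two families agree, each function on its own closed interval. -/
def Agree (w w' : Pieces n) : Prop :=
  (EqOn w.z₁ w'.z₁ (Icc 0 D.α) ∧ EqOn w.z₂ w'.z₂ (Icc D.α D.s) ∧
    EqOn w.z₃ w'.z₃ (Icc D.s D.β) ∧ EqOn w.z₄ w'.z₄ (Icc D.β D.T)) ∧
  (EqOn w.p₁ w'.p₁ (Icc 0 D.α) ∧ EqOn w.p₂ w'.p₂ (Icc D.α D.s) ∧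
    EqOn w.p₃ w'.p₃ (Icc D.s D.β) ∧ EqOn w.p₄ w'.p₄ (Icc D.β D.T))

/-- The function `z̃` glued from `z₁, z₂, z₃, z₄`. -/
def glued (w : Pieces n) (t : ℝ) : Fin n → ℝ :=
  if t < D.α then w.z₁ t else if t < D.s then w.z₂ t else if t < D.β then w.z₃ t else w.z₄ t

/-- The constant `ĉ = (B̄₀ z₁(0), f₀⁽⁰⁾) - (B̄₁ z₄(T), f₁⁽⁰⁾) + ∫₀ᵀ (z̃(t), f⁽⁰⁾(t)) dt`. -/
def cHat (w : Pieces n) : ℝ :=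
  (D.B₀bar *ᵥ w.z₁ 0) ⬝ᵥ D.f₀c - (D.B₁bar *ᵥ w.z₄ D.T) ⬝ᵥ D.f₁c
    + ∫ t in (0 : ℝ)..D.T, D.glued w t ⬝ᵥ D.fc t

/-- `û₁ = Q H p₂`. -/
def uHat₁ (w : Pieces n) (t : ℝ) : Fin l → ℝ := D.Q t *ᵥ (D.H t *ᵥ w.p₂ t)

/-- `û₂ = Q H p₃`. -/
def uHat₂ (w : Pieces n) (t : ℝ) : Fin l → ℝ := D.Q t *ᵥ (D.H t *ᵥ w.p₃ t)

end Data

end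

end TwoPoint

/-! The optimal weights come from duality. Green's identity, applied on the four intervals with the
jump of $z$ at $s$, turns $(a,\varphi(s))$ into a linear functional of the data $(f_0,f_1,f)$ plus
$\int_\alpha^\beta(QHp,H\varphi)$. The boundary terms depend on the data only, because $\hat Bz=0$
puts $z$ in the row space of $B$ (`dotProduct_eq_barMatrix`, `dotProduct_eq_functional`). The glued
$p$ is itself a state: its data are the Riesz representative of that functional in the inner product
of the ellipsoid. Testing the identity with $p$ gives `energy`: $(a,p_2(s))=q+\nu$, where $q\ge 0$
(`dataError`) is the squared norm of the functional and $\nu\ge 0$ (`noiseError`) is the integral of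
$(QHp,Hp)$.

Solvability of the coupled system follows from `energy`. With zero jump it forces $z=0$, and then
$p$ solves the homogeneous boundary value problem, so $p=0$. The number of free parameters equals
the number of conditions, so uniqueness gives existence (`exists_left_of_linear_relation`).

Upper bound (`worstError_le`): for the claimed estimate the error is the functional at the deviation
from the centre minus a centred noise term. Its mean square splits into two parts, and
Cauchy–Schwarz bounds them by $q$ and $\nu$.

Lower bound (`le_worstError`): an arbitrary $(u,c)$ is tested against the centre shifted by a
multiple of the Riesz representative, and against the rank-one noise proportional to $\eta\,Q^{-1}u$
with $\eta$ a standardized random variable. The worst error is then at least $q+\nu$ plus the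
squared $Q^{-1}$-norm of $u-QHp$ plus the squared bias at the centre. The two surplus terms vanish
only for the claimed estimate, which gives the value and the uniqueness at once. -/

namespace TwoPoint

/-! ### Linear algebra: solvability by dimension, boundary matrices, positive definite forms. -/

section LinearAlgebra

/-- If initial values (`π`) can be prescribed arbitrarily, are as many as the conditions (`ρ`), and
are annihilated by the homogeneous conditions, then the conditions can be prescribed as well. -/
theorem surjective_of_ker_le {V E F : Type*} [AddCommGroup V] [Module ℝ V] [AddCommGroup E]
    [Module ℝ E] [AddCommGroup F] [Module ℝ F] [FiniteDimensional ℝ E] [FiniteDimensional ℝ F]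
    (hd : Module.finrank ℝ E = Module.finrank ℝ F) (π : V →ₗ[ℝ] E) (ρ : V →ₗ[ℝ] F)
    (hπ : Function.Surjective π) (hk : ∀ x, ρ x = 0 → π x = 0) : Function.Surjective ρ := by
  -- As `ker ρ ≤ ker π`, the map `π` factors through the range of `ρ`, and the factor extends to `g`
  -- on all of `F`. Surjectivity of `π` makes `g` surjective, hence injective by equality of
  -- dimensions, and injectivity of `g` carries surjectivity back to `ρ`.
  obtain ⟨g, hg⟩ := (LinearMap.exists_extend
    ((LinearMap.ker ρ).liftQ π (fun x hx => hk x hx) ∘ₗ ρ.quotKerEquivRange.symm.toLinearMap))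
  have hgρ : ∀ x, g (ρ x) = π x := by
    intro x
    have := LinearMap.congr_fun hg ⟨ρ x, LinearMap.mem_range_self ρ x⟩
    simp only [LinearMap.comp_apply, Submodule.subtype_apply] at this
    rw [this]
    have h2 : ρ.quotKerEquivRange.symm ⟨ρ x, LinearMap.mem_range_self ρ x⟩
        = Submodule.Quotient.mk x := by
      rw [LinearEquiv.symm_apply_eq]
      rfl
    rw [LinearEquiv.coe_coe, h2]
    exact Submodule.liftQ_apply _ _ _
  have hgs : Function.Surjective g := fun y => by
    obtain ⟨x, rfl⟩ := hπ y
    exact ⟨ρ x, hgρ x⟩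
  have hgi : Function.Injective g :=
    (LinearMap.injective_iff_surjective_of_finrank_eq_finrank hd.symm).2 hgs
  intro y
  obtain ⟨x, hx⟩ := hπ (g y)
  exact ⟨x, hgi ((hgρ x).trans hx)⟩

/-- The condition $\hat Bz=0$ expresses the remaining coordinates of $z$ through the selected ones
in such a way that $z=B^Tw$ with $w=\bar Bz$. Thus the boundary term of Green's identity sees $x$
only through $Bx$. -/
theorem dotProduct_eq_barMatrix {μ ν ι : Type*} [Fintype μ] [DecidableEq μ] [Fintype ν]
    [DecidableEq ν] [Fintype ι] (e : μ ⊕ ν ≃ ι) (B : Matrix μ ι ℝ)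
    (hB : (selectedCols e B).det ≠ 0) {z : ι → ℝ} (hz : hatMatrix e B *ᵥ z = 0) (x : ι → ℝ) :
    z ⬝ᵥ x = (barMatrix e B *ᵥ z) ⬝ᵥ (B *ᵥ x) := by
  set B1 := selectedCols e B
  set B2 := remainingCols e B
  have hsplit : ∀ (v w : ι → ℝ), v ⬝ᵥ w = (fun k => v (e (Sum.inl k))) ⬝ᵥ (fun k => w (e (Sum.inl k)))
      + (fun k => v (e (Sum.inr k))) ⬝ᵥ (fun k => w (e (Sum.inr k))) := by
    intro v w
    simp only [dotProduct]
    rw [← e.sum_comp, Fintype.sum_sum_type]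
  have hw : barMatrix e B *ᵥ z = (B1ᵀ)⁻¹ *ᵥ (fun k => z (e (Sum.inl k))) := by
    ext i
    simp only [Matrix.mulVec]
    rw [hsplit]
    simp [barMatrix, dotProduct, B1]
  set w := barMatrix e B *ᵥ z
  have hz2 : (fun k => z (e (Sum.inr k))) = B2ᵀ *ᵥ w := by
    rw [hw]
    ext i
    have := congrFun hz i
    simp only [Matrix.mulVec] at this
    rw [hsplit] at this
    have h1 : (fun k => hatMatrix e B i (e (Sum.inl k))) = (-(B2ᵀ * (B1ᵀ)⁻¹)) i := by
      ext k; simp [hatMatrix, B1, B2]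
    have h2 : (fun k => hatMatrix e B i (e (Sum.inr k))) = (1 : Matrix ν ν ℝ) i := by
      ext k; simp [hatMatrix]
    rw [h1, h2] at this
    have h3 : (1 : Matrix ν ν ℝ) i ⬝ᵥ (fun k => z (e (Sum.inr k))) = z (e (Sum.inr i)) := by
      simp [dotProduct, Matrix.one_apply]
    rw [h3] at this
    rw [Matrix.mulVec_mulVec]
    have h4 : (-(B2ᵀ * (B1ᵀ)⁻¹)) i ⬝ᵥ (fun k => z (e (Sum.inl k)))
      = -((B2ᵀ * (B1ᵀ)⁻¹) i ⬝ᵥ (fun k => z (e (Sum.inl k)))) := by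
      rw [← neg_dotProduct]; rfl
    rw [h4] at this
    simp only [Matrix.mulVec]
    simp only [Pi.zero_apply] at this
    linarith
  have hz1 : (fun k => z (e (Sum.inl k))) = B1ᵀ *ᵥ w := by
    rw [hw, Matrix.mulVec_mulVec, Matrix.mul_nonsing_inv, Matrix.one_mulVec]
    rw [Matrix.det_transpose]; exact isUnit_iff_ne_zero.2 hB
  have hx : B *ᵥ x = B1 *ᵥ (fun k => x (e (Sum.inl k))) + B2 *ᵥ (fun k => x (e (Sum.inr k))) := by
    ext i
    simp only [Matrix.mulVec, Pi.add_apply]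
    rw [hsplit]
    rfl
  rw [hsplit, hz1, hz2, hx, dotProduct_add, Matrix.mulVec_transpose, Matrix.mulVec_transpose,
    ← Matrix.dotProduct_mulVec, ← Matrix.dotProduct_mulVec]

variable {k : Type*} [Fintype k] 

theorem posDef_mulVec_dotProduct_nonneg {M : Matrix k k ℝ} (hM : M.PosDef) (x : k → ℝ) :
    0 ≤ (M *ᵥ x) ⬝ᵥ x := by
  have := hM.posSemidef.dotProduct_mulVec_nonneg x
  simpa [dotProduct_comm] using this

theorem posDef_eq_zero {M : Matrix k k ℝ} (hM : M.PosDef) {x : k → ℝ}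
    (h : (M *ᵥ x) ⬝ᵥ x = 0) : x = 0 := by
  by_contra hx
  have := hM.dotProduct_mulVec_pos hx
  simp only [star_trivial] at this
  rw [dotProduct_comm, h] at this
  exact this.false

theorem posDef_symm {M : Matrix k k ℝ} (hM : M.PosDef) (x y : k → ℝ) :
    (M *ᵥ x) ⬝ᵥ y = x ⬝ᵥ (M *ᵥ y) := by
  have : Mᵀ = M := by simpa using hM.isHermitian.eq
  rw [Matrix.dotProduct_mulVec, ← Matrix.mulVec_transpose, this]

theorem mulVec_inv_mulVec [DecidableEq k] {M : Matrix k k ℝ} (hM : M.PosDef) (x : k → ℝ) :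
    M *ᵥ (M⁻¹ *ᵥ x) = x := by
  rw [Matrix.mulVec_mulVec, Matrix.mul_nonsing_inv _ (isUnit_iff_ne_zero.2 hM.det_pos.ne'),
    Matrix.one_mulVec]

theorem inv_mulVec_mulVec [DecidableEq k] {M : Matrix k k ℝ} (hM : M.PosDef) (x : k → ℝ) :
    M⁻¹ *ᵥ (M *ᵥ x) = x := by
  rw [Matrix.mulVec_mulVec, Matrix.nonsing_inv_mul _ (isUnit_iff_ne_zero.2 hM.det_pos.ne'),
    Matrix.one_mulVec]

theorem continuousOn_matrix_inv [DecidableEq k] {M : ℝ → Matrix k k ℝ} {S : Set ℝ}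
    (hM : ContinuousOn M S) (hpos : ∀ t ∈ S, (M t).PosDef) : ContinuousOn (fun t => (M t)⁻¹) S := by
  have : (fun t => (M t)⁻¹) = fun t => ((M t).det)⁻¹ • (M t).adjugate := by
    ext t : 1
    rw [Matrix.inv_def, Ring.inverse_eq_inv']
  rw [this]
  refine ContinuousOn.smul (ContinuousOn.inv₀ ?_ fun t ht => (hpos t ht).det_pos.ne') ?_
  · exact (Continuous.matrix_det continuous_id).comp_continuousOn hM
  · exact (Continuous.matrix_adjugate continuous_id).comp_continuousOn hM

theorem continuousOn_mulVec {k' : Type*} {M : ℝ → Matrix k' k ℝ} {x : ℝ → k → ℝ}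
    {S : Set ℝ} (hM : ContinuousOn M S) (hx : ContinuousOn x S) :
    ContinuousOn (fun t => M t *ᵥ x t) S := by
  have : Continuous fun p : Matrix k' k ℝ × (k → ℝ) => p.1 *ᵥ p.2 :=
    Continuous.matrix_mulVec continuous_fst continuous_snd
  exact this.comp_continuousOn (hM.prodMk hx)

theorem continuousOn_dotProduct {x y : ℝ → k → ℝ}
    {S : Set ℝ} (hx : ContinuousOn x S) (hy : ContinuousOn y S) :
    ContinuousOn (fun t => x t ⬝ᵥ y t) S := by
  have : Continuous fun p : (k → ℝ) × (k → ℝ) => p.1 ⬝ᵥ p.2 :=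
    Continuous.dotProduct continuous_fst continuous_snd
  exact this.comp_continuousOn (hx.prodMk hy)

end LinearAlgebra

end TwoPoint

namespace TwoPoint

/-! ### The space $H^1$ and gluing across a node. -/

section AbsolutelyContinuous

theorem absolutelyContinuousOnInterval_of_dist_eq {f g : ℝ → ℝ} {a b : ℝ}
    (hf : AbsolutelyContinuousOnInterval f a b)
    (h : ∀ x ∈ uIcc a b, ∀ y ∈ uIcc a b, dist (g x) (g y) = dist (f x) (f y)) :
    AbsolutelyContinuousOnInterval g a b := by
  rw [absolutelyContinuousOnInterval_iff] at hf ⊢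
  intro ε hε
  obtain ⟨δ, hδ, H⟩ := hf ε hε
  refine ⟨δ, hδ, fun E hE hs => ?_⟩
  convert H E hE hs using 1
  refine Finset.sum_congr rfl fun i hi => ?_
  exact h _ (hE.1 i hi).1 _ (hE.1 i hi).2

theorem _root_.MeasureTheory.MemLp.intervalIntegrable_of_Ioo {E : Type*} [NormedAddCommGroup E]
    {h : ℝ → E} {a b : ℝ} (hab : a ≤ b) (hh : MemLp h 2 (volume.restrict (Ioo a b))) :
    IntervalIntegrable h volume a b := by
  rw [intervalIntegrable_iff_integrableOn_Ioo_of_le hab]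
  exact hh.integrable (by norm_num)

theorem ae_hasDerivAt_of_primitive {E : Type*} [NormedAddCommGroup E] [NormedSpace ℝ E]
    [CompleteSpace E] {h φ : ℝ → E} {a b : ℝ} (hab : a ≤ b)
    (hh : IntervalIntegrable h volume a b)
    (hφ : ∀ t ∈ Icc a b, φ t = φ a + ∫ τ in a..t, h τ) :
    ∀ᵐ t ∂(volume.restrict (Ioo a b)), HasDerivAt φ (h t) t := by
  rw [ae_restrict_iff' measurableSet_Ioo]
  filter_upwards [hh.ae_hasDerivAt_integral] with t ht htm
  have h1 := (ht (by rw [uIcc_of_le hab]; exact Ioo_subset_Icc_self htm) a left_mem_uIcc).const_add (φ a)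
  refine h1.congr_of_eventuallyEq ?_
  filter_upwards [isOpen_Ioo.mem_nhds htm] with y hy
  exact hφ y (Ioo_subset_Icc_self hy)

/-- The working criterion for $H^1$: gluing, restriction to a closed interval and linear
combinations are all checked on the integral representation. -/
theorem isH1_of_primitive {h f : ℝ → ℝ} {a b : ℝ} (hab : a ≤ b)
    (hh : MemLp h 2 (volume.restrict (Ioo a b)))
    (hf : ∀ t ∈ Icc a b, f t = f a + ∫ τ in a..t, h τ) : IsH1 a b f := by
  have hi := hh.intervalIntegrable_of_Ioo hab
  refine ⟨?_, ?_⟩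
  · refine absolutelyContinuousOnInterval_of_dist_eq
      (hi.absolutelyContinuousOnInterval_intervalIntegral (c := a) left_mem_uIcc) ?_
    intro x hx y hy
    rw [uIcc_of_le hab] at hx hy
    rw [hf x hx, hf y hy, dist_add_left]
  · refine hh.ae_eq ?_
    filter_upwards [ae_hasDerivAt_of_primitive hab hi hf] with t ht
    exact ht.deriv.symm

theorem AbsolutelyContinuousOnInterval.eq_add_integral {f : ℝ → ℝ} {a b : ℝ} (hab : a ≤ b)
    (hf : AbsolutelyContinuousOnInterval f a b) {t : ℝ} (ht : t ∈ Icc a b) :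
    f t = f a + ∫ τ in a..t, deriv f τ := by
  rw [_root_.AbsolutelyContinuousOnInterval.integral_deriv_eq_sub (hf.mono _)]
  · ring
  · rw [uIcc_of_le hab, uIcc_of_le ht.1]; exact Icc_subset_Icc_right ht.2

theorem IsH1.continuousOn {f : ℝ → ℝ} {a b : ℝ} (hab : a ≤ b) (hf : IsH1 a b f) :
    ContinuousOn f (Icc a b) := by
  have := hf.1.continuousOn
  rwa [uIcc_of_le hab] at this

theorem restrict_Ioo_le_add {a b c : ℝ} :
    (volume : Measure ℝ).restrict (Ioo a c) ≤ volume.restrict (Ioo a b) + volume.restrict (Ioo b c) := by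
  have h1 : (Ioo a c : Set ℝ) ≤ᵐ[volume] (Ioo a b ∪ Ioo b c : Set ℝ) := by
    have : ∀ᵐ t : ℝ, t ≠ b := by simp [ae_iff]
    filter_upwards [this] with t ht htm
    rcases lt_or_gt_of_ne ht with h | h
    · exact Or.inl ⟨htm.1, h⟩
    · exact Or.inr ⟨h, htm.2⟩
  exact (Measure.restrict_mono_ae h1).trans (Measure.restrict_union_le _ _)

theorem memLp_Ioo_glue {E : Type*} [NormedAddCommGroup E] {h : ℝ → E} {a b c : ℝ}
    (h1 : MemLp h 2 (volume.restrict (Ioo a b))) (h2 : MemLp h 2 (volume.restrict (Ioo b c))) :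
    MemLp h 2 (volume.restrict (Ioo a c)) := by
  classical
  rw [← Set.piecewise_same (Iio b) h]
  refine MemLp.piecewise measurableSet_Iio (h1.mono_measure ?_) (h2.mono_measure ?_)
  · rw [Measure.restrict_restrict measurableSet_Iio]
    have hs : Iio b ∩ Ioo a c ⊆ Ioo a b := fun t ht => ⟨ht.2.1, ht.1⟩
    exact Measure.restrict_mono hs le_rfl
  · rw [Measure.restrict_restrict measurableSet_Iio.compl,
      Measure.restrict_congr_set (Ioo_ae_eq_Ico (a := b) (b := c))]
    have hs : (Iio b)ᶜ ∩ Ioo a c ⊆ Ico b c := fun t ht => ⟨not_lt.1 ht.1, ht.2.2⟩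
    exact Measure.restrict_mono hs le_rfl

theorem ae_Ioo_glue {p : ℝ → Prop} {a b c : ℝ}
    (h1 : ∀ᵐ t ∂volume.restrict (Ioo a b), p t) (h2 : ∀ᵐ t ∂volume.restrict (Ioo b c), p t) :
    ∀ᵐ t ∂volume.restrict (Ioo a c), p t := by
  exact ae_mono (restrict_Ioo_le_add (b := b)) (ae_add_measure_iff.2 ⟨h1, h2⟩)

theorem IsH1.glue {f : ℝ → ℝ} {a b c : ℝ} (hab : a ≤ b) (hbc : b ≤ c) (h1 : IsH1 a b f)
    (h2 : IsH1 b c f) : IsH1 a c f := by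
  refine isH1_of_primitive (h := deriv f) (hab.trans hbc) (memLp_Ioo_glue h1.2 h2.2) ?_
  intro t ht
  rcases le_total t b with h | h
  · exact AbsolutelyContinuousOnInterval.eq_add_integral hab h1.1 ⟨ht.1, h⟩
  · have e1 := AbsolutelyContinuousOnInterval.eq_add_integral hab h1.1 ⟨hab, le_rfl⟩
    have e2 := AbsolutelyContinuousOnInterval.eq_add_integral hbc h2.1 ⟨h, ht.2⟩
    rw [e2, e1, add_assoc, intervalIntegral.integral_add_adjacent_intervals]
    · exact h1.1.intervalIntegrable_deriv
    · refine h2.1.intervalIntegrable_deriv.mono_set ?_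
      rw [uIcc_of_le h, uIcc_of_le hbc]; exact Icc_subset_Icc_right ht.2

theorem IsH1.congr {f g : ℝ → ℝ} {a b : ℝ} (hab : a ≤ b) (hf : IsH1 a b f)
    (h : EqOn g f (Icc a b)) : IsH1 a b g := by
  refine isH1_of_primitive (h := deriv f) hab hf.2 fun t ht => ?_
  rw [h ht, h ⟨le_rfl, hab⟩]
  exact AbsolutelyContinuousOnInterval.eq_add_integral hab hf.1 ht

theorem IsH1.linear_comb {f g : ℝ → ℝ} {a b : ℝ} (hab : a ≤ b) (c : ℝ) (hf : IsH1 a b f)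
    (hg : IsH1 a b g) : IsH1 a b (fun t => c * f t + g t) := by
  refine isH1_of_primitive (h := fun t => c * deriv f t + deriv g t) hab
    ((hf.2.const_mul c).add hg.2) fun t ht => ?_
  have hs : uIcc a t ⊆ uIcc a b := by
    rw [uIcc_of_le hab, uIcc_of_le ht.1]; exact Icc_subset_Icc_right ht.2
  rw [intervalIntegral.integral_add ((hf.1.intervalIntegrable_deriv.mono_set hs).const_mul c)
    (hg.1.intervalIntegrable_deriv.mono_set hs), intervalIntegral.integral_const_mul,
    AbsolutelyContinuousOnInterval.eq_add_integral hab hf.1 ht,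
    AbsolutelyContinuousOnInterval.eq_add_integral hab hg.1 ht]
  ring

end AbsolutelyContinuous

/-! ### Solutions of the direct and adjoint equations, Green's identity. -/

section Solutions

variable {n : ℕ} {A : ℝ → Matrix (Fin n) (Fin n) ℝ} {a b c : ℝ} {g h φ ψ z : ℝ → Fin n → ℝ}

/-- The adjoint equation is a direct one with coefficient $-A^T$, so facts about `SolvesDirect`
transfer. -/
theorem solvesAdjoint_iff : SolvesAdjoint A a b g ψ ↔
    SolvesDirect (fun t => -(A t)ᵀ) a b (fun t => -g t) ψ := by
  have : ∀ t, (A t)ᵀ *ᵥ ψ t - g t = -g t - -(A t)ᵀ *ᵥ ψ t := by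
    intro t; rw [Matrix.neg_mulVec]; abel
  simp only [SolvesAdjoint, SolvesDirect, this]

theorem SolvesDirect.continuousOn (hab : a ≤ b) (hφ : SolvesDirect A a b g φ) :
    ContinuousOn φ (Icc a b) :=
  continuousOn_pi.2 fun i => (hφ.1 i).continuousOn hab

theorem SolvesAdjoint.continuousOn (hab : a ≤ b) (hφ : SolvesAdjoint A a b g φ) :
    ContinuousOn φ (Icc a b) :=
  continuousOn_pi.2 fun i => (hφ.1 i).continuousOn hab

theorem SolvesDirect.congr (hab : a ≤ b) (hφ : SolvesDirect A a b g φ)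
    (hψ : EqOn ψ φ (Icc a b)) (hg : ∀ᵐ t ∂volume.restrict (Ioo a b), h t = g t) :
    SolvesDirect A a b h ψ := by
  refine ⟨fun i => (hφ.1 i).congr hab fun t ht => congrFun (hψ ht) i, ?_⟩
  filter_upwards [hφ.2, hg, ae_restrict_mem measurableSet_Ioo] with t h1 h2 ht
  rw [h2, hψ (Ioo_subset_Icc_self ht)]
  refine h1.congr_of_eventuallyEq ?_
  filter_upwards [isOpen_Ioo.mem_nhds ht] with y hy
  exact hψ (Ioo_subset_Icc_self hy)

theorem SolvesDirect.glue (hab : a ≤ b) (hbc : b ≤ c) (h1 : SolvesDirect A a b g φ)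
    (h2 : SolvesDirect A b c g φ) : SolvesDirect A a c g φ :=
  ⟨fun i => (h1.1 i).glue hab hbc (h2.1 i), ae_Ioo_glue h1.2 h2.2⟩

theorem SolvesDirect.linear_comb (hab : a ≤ b) (k : ℝ) (h1 : SolvesDirect A a b g φ)
    (h2 : SolvesDirect A a b h ψ) :
    SolvesDirect A a b (fun t => k • g t + h t) (fun t => k • φ t + ψ t) := by
  refine ⟨fun i => (h1.1 i).linear_comb hab k (h2.1 i), ?_⟩
  filter_upwards [h1.2, h2.2] with t d1 d2
  have e : k • g t + h t - A t *ᵥ (k • φ t + ψ t)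
      = k • (g t - A t *ᵥ φ t) + (h t - A t *ᵥ ψ t) := by
    rw [Matrix.mulVec_add, Matrix.mulVec_smul, smul_sub]
    abel
  rw [e]
  exact (d1.const_smul k).add d2

theorem SolvesAdjoint.linear_comb (hab : a ≤ b) (k : ℝ) (h1 : SolvesAdjoint A a b g φ)
    (h2 : SolvesAdjoint A a b h ψ) :
    SolvesAdjoint A a b (fun t => k • g t + h t) (fun t => k • φ t + ψ t) := by
  rw [solvesAdjoint_iff] at *
  have := h1.linear_comb hab k h2
  refine this.congr hab (fun _ _ => rfl) (Filter.Eventually.of_forall fun t => ?_)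
  simp only [smul_neg, neg_add]

theorem solvesDirect_of_primitive (hab : a ≤ b)
    (hg : MemLp (fun t => g t - A t *ᵥ φ t) 2 (volume.restrict (Ioo a b)))
    (hφ : ∀ t ∈ Icc a b, φ t = φ a + ∫ τ in a..t, (g τ - A τ *ᵥ φ τ)) :
    SolvesDirect A a b g φ := by
  have hi := hg.intervalIntegrable_of_Ioo hab
  refine ⟨fun i => ?_, ae_hasDerivAt_of_primitive hab hi hφ⟩
  refine isH1_of_primitive (h := fun t => (g t - A t *ᵥ φ t) i) hab ?_ fun t ht => ?_
  · exact (memLp_pi_iff.1 hg) i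
  · have hs : uIcc a t ⊆ uIcc a b := by
      rw [uIcc_of_le hab, uIcc_of_le ht.1]; exact Icc_subset_Icc_right ht.2
    have := (ContinuousLinearMap.proj (R := ℝ) (φ := fun _ : Fin n => ℝ) i).intervalIntegral_comp_comm
      (hi.mono_set hs)
    simp only [ContinuousLinearMap.proj_apply] at this
    rw [this]
    exact congrFun (hφ t ht) i

/-- Green's identity for the operators `L` and `L*`. -/
theorem green (hab : a ≤ b) (hφ : SolvesDirect A a b g φ) (hz : SolvesAdjoint A a b h z) :
    z b ⬝ᵥ φ b - z a ⬝ᵥ φ a = ∫ t in a..b, (z t ⬝ᵥ g t - h t ⬝ᵥ φ t) := by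
  have key : ∀ i, ∫ t in a..b, (deriv (fun t => z t i) t * φ t i + z t i * deriv (fun t => φ t i) t)
      = z b i * φ b i - z a i * φ a i := fun i =>
    (hz.1 i).1.integral_deriv_mul_eq_sub (hφ.1 i).1
  simp only [dotProduct]
  rw [← Finset.sum_sub_distrib]
  simp only [← key]
  rw [← intervalIntegral.integral_finsetSum]
  · rw [intervalIntegral.integral_of_le hab, intervalIntegral.integral_of_le hab,
      integral_Ioc_eq_integral_Ioo, integral_Ioc_eq_integral_Ioo]
    refine integral_congr_ae ?_
    filter_upwards [hφ.2, hz.2] with t d1 d2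
    have e1 : ∀ i, deriv (fun t => φ t i) t = (g t - A t *ᵥ φ t) i := fun i =>
      (hasDerivAt_pi.1 d1 i).deriv
    have e2 : ∀ i, deriv (fun t => z t i) t = ((A t)ᵀ *ᵥ z t - h t) i := fun i =>
      (hasDerivAt_pi.1 d2 i).deriv
    simp only [e1, e2]
    have : ((A t)ᵀ *ᵥ z t - h t) ⬝ᵥ φ t + z t ⬝ᵥ (g t - A t *ᵥ φ t)
        = z t ⬝ᵥ g t - h t ⬝ᵥ φ t := by
      rw [sub_dotProduct, dotProduct_sub, Matrix.mulVec_transpose, Matrix.dotProduct_mulVec]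
      ring
    rw [dotProduct, dotProduct, dotProduct, dotProduct] at this
    rw [Finset.sum_add_distrib]
    exact this
  · intro i _
    have c1 := (hφ.1 i).1.continuousOn
    have c2 := (hz.1 i).1.continuousOn
    exact ((hz.1 i).1.intervalIntegrable_deriv.mul_continuousOn c1).add
      ((hφ.1 i).1.intervalIntegrable_deriv.continuousOn_mul c2)

end Solutions

end TwoPoint

namespace TwoPoint

/-! ### Global existence for Lipschitz and linear initial value problems. -/

section Existence

open scoped NNReal

variable {E : Type*} [NormedAddCommGroup E] [NormedSpace ℝ E] [CompleteSpace E]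

/-- Picard–Lindelöf on the ball of radius $2M\delta$ about $v$, where $M$ bounds $F(\cdot,v)$ and
$\delta=d-c$. There the speed is at most $2KM\delta+M$, so $K\delta\le 1/2$ keeps the solution
inside the ball. -/
theorem exists_solution_of_short {F : ℝ → E → E} {K : ℝ≥0} {c d : ℝ} (hcd : c ≤ d)
    (hL : ∀ t ∈ Icc c d, LipschitzWith K (F t)) (hc : ∀ x, ContinuousOn (fun t => F t x) (Icc c d))
    (hK : K * (d - c) ≤ 1 / 2) (v : E) :
    ∃ x : ℝ → E, x c = v ∧ ∀ t ∈ Icc c d, HasDerivWithinAt x (F t (x t)) (Icc c d) t := by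
  obtain ⟨M, hM⟩ := isCompact_Icc.exists_bound_of_continuousOn (hc v)
  have hM0 : 0 ≤ M := (norm_nonneg _).trans (hM c ⟨le_rfl, hcd⟩)
  lift M to ℝ≥0 using hM0
  obtain ⟨δ, hδ⟩ : ∃ δ : ℝ≥0, (δ : ℝ) = d - c := ⟨⟨d - c, sub_nonneg.2 hcd⟩, rfl⟩
  have hpl : IsPicardLindelof F (tmin := c) (tmax := d) ⟨c, le_rfl, hcd⟩ v (2 * M * δ) 0
      (K * (2 * M * δ) + M) K := by
    refine ⟨fun t ht => (hL t ht).lipschitzOnWith, fun x _ => hc x, fun t ht x hx => ?_, ?_⟩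
    · have h1 : ‖F t x - F t v‖ ≤ K * ‖x - v‖ := by
        simpa [dist_eq_norm] using (hL t ht).dist_le_mul x v
      have h2 : ‖x - v‖ ≤ 2 * M * δ := by simpa [dist_eq_norm] using hx
      have h3 : ‖F t x‖ ≤ ‖F t x - F t v‖ + ‖F t v‖ := by
        simpa using norm_add_le (F t x - F t v) (F t v)
      have h4 := hM t ht
      have h5 : (K : ℝ) * ‖x - v‖ ≤ K * (2 * M * δ) := by gcongr
      push_cast
      linarith
    · have hm : max (d - c) (c - c) = (δ : ℝ) := by
        rw [hδ, max_eq_left]; linarith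
      simp only [hm]
      push_cast
      rw [← hδ] at hK
      have : (K : ℝ) * δ * (2 * M * δ) ≤ 1 / 2 * (2 * M * δ) := by gcongr
      simp only [sub_zero]
      nlinarith
  exact hpl.exists_eq_forall_mem_Icc_hasDerivWithinAt₀

omit [CompleteSpace E] in
theorem hasDerivWithinAt_glue {x x₁ x₂ : ℝ → E} {f : ℝ → E} {a b c : ℝ} (hab : a ≤ b) (hbc : b ≤ c)
    (hx₁ : EqOn x x₁ (Icc a b)) (hx₂ : EqOn x x₂ (Icc b c))
    (h1 : ∀ t ∈ Icc a b, HasDerivWithinAt x₁ (f t) (Icc a b) t)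
    (h2 : ∀ t ∈ Icc b c, HasDerivWithinAt x₂ (f t) (Icc b c) t) :
    ∀ t ∈ Icc a c, HasDerivWithinAt x (f t) (Icc a c) t := by
  intro t ht
  rw [← Icc_union_Icc_eq_Icc hab hbc]
  refine HasDerivWithinAt.union ?_ ?_
  · by_cases h : t ∈ Icc a b
    · exact (h1 t h).congr hx₁ (hx₁ h)
    · exact HasFDerivWithinAt.of_notMem_closure (by rwa [isClosed_Icc.closure_eq])
  · by_cases h : t ∈ Icc b c
    · exact (h2 t h).congr hx₂ (hx₂ h)
    · exact HasFDerivWithinAt.of_notMem_closure (by rwa [isClosed_Icc.closure_eq])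

/-- The uniform Lipschitz constant makes the admissible step length independent of the initial
value, so repeated halving of the interval and gluing at midpoints reach all of $[a,b]$. -/
theorem exists_solution_of_lipschitz {F : ℝ → E → E} {K : ℝ≥0} {a b : ℝ} (hab : a ≤ b)
    (hL : ∀ t ∈ Icc a b, LipschitzWith K (F t)) (hc : ∀ x, ContinuousOn (fun t => F t x) (Icc a b))
    (v : E) :
    ∃ x : ℝ → E, x a = v ∧ ∀ t ∈ Icc a b, HasDerivWithinAt x (F t (x t)) (Icc a b) t := by
  have key : ∀ (k : ℕ) (c d : ℝ), a ≤ c → c ≤ d → d ≤ b → K * (d - c) ≤ 2 ^ k * (1 / 2) → ∀ v : E,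
      ∃ x : ℝ → E, x c = v ∧ ∀ t ∈ Icc c d, HasDerivWithinAt x (F t (x t)) (Icc c d) t := by
    intro k
    induction k with
    | zero =>
      intro c d hac hcd hdb hk v
      have hs : Icc c d ⊆ Icc a b := Icc_subset_Icc hac hdb
      exact exists_solution_of_short hcd (fun t ht => hL t (hs ht)) (fun x => (hc x).mono hs)
        (by simpa using hk) v
    | succ k ih =>
      intro c d hac hcd hdb hk v
      have hm1 : c ≤ (c + d) / 2 := by linarith
      have hm2 : (c + d) / 2 ≤ d := by linarith
      obtain ⟨x₁, hx₁, hd₁⟩ := ih c ((c + d) / 2) hac hm1 (by linarith)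
        (by rw [pow_succ] at hk; linarith) v
      obtain ⟨x₂, hx₂, hd₂⟩ := ih ((c + d) / 2) d (by linarith) hm2 hdb
        (by rw [pow_succ] at hk; linarith) (x₁ ((c + d) / 2))
      set x : ℝ → E := fun t => if t ≤ (c + d) / 2 then x₁ t else x₂ t
      have e₁ : EqOn x x₁ (Icc c ((c + d) / 2)) := fun t ht => if_pos ht.2
      have e₂ : EqOn x x₂ (Icc ((c + d) / 2) d) := fun t ht => by
        rcases eq_or_lt_of_le ht.1 with h | h
        · rw [e₁ ⟨by linarith, h.ge⟩, ← h, hx₂]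
        · exact if_neg (not_le.2 h)
      refine ⟨x, (e₁ ⟨le_rfl, hm1⟩).trans hx₁, ?_⟩
      refine hasDerivWithinAt_glue hm1 hm2 e₁ e₂ (fun t ht => ?_) (fun t ht => ?_)
      · rw [e₁ ht]; exact hd₁ t ht
      · rw [e₂ ht]; exact hd₂ t ht
  obtain ⟨k, hk⟩ := pow_unbounded_of_one_lt (2 * (K * (b - a))) one_lt_two
  exact key k a b le_rfl hab le_rfl (by linarith) v

theorem exists_solution_matrix {ι : Type*} [Fintype ι] {M : ℝ → Matrix ι ι ℝ}
    {G : ℝ → ι → ℝ} {a b : ℝ} (hab : a ≤ b) (hM : ContinuousOn M (Icc a b))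
    (hG : ContinuousOn G (Icc a b)) (v : ι → ℝ) :
    ∃ x : ℝ → ι → ℝ, x a = v ∧
      ∀ t ∈ Icc a b, HasDerivWithinAt x (M t *ᵥ x t + G t) (Icc a b) t := by
  classical
  let Λ : Matrix ι ι ℝ →ₗ[ℝ] ((ι → ℝ) →L[ℝ] (ι → ℝ)) :=
    LinearMap.toContinuousLinearMap.toLinearMap ∘ₗ (Matrix.toLin' (R := ℝ) (m := ι) (n := ι)).toLinearMap
  have hΛ : Continuous Λ := LinearMap.continuous_of_finiteDimensional Λ
  obtain ⟨K, hK⟩ := isCompact_Icc.exists_bound_of_continuousOn (hΛ.comp_continuousOn hM)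
  have hK0 : 0 ≤ K := (norm_nonneg _).trans (hK a ⟨le_rfl, hab⟩)
  lift K to ℝ≥0 using hK0
  refine exists_solution_of_lipschitz (K := K) (F := fun t x => M t *ᵥ x + G t) hab ?_ ?_ v
  · intro t ht
    refine LipschitzWith.of_dist_le_mul fun x y => ?_
    have h1 : M t *ᵥ x + G t - (M t *ᵥ y + G t) = Λ (M t) (x - y) := by
      have : Λ (M t) (x - y) = M t *ᵥ (x - y) := rfl
      rw [this, Matrix.mulVec_sub]; abel
    rw [dist_eq_norm, dist_eq_norm, h1]
    exact (ContinuousLinearMap.le_opNorm _ _).trans (by gcongr; exact hK t ht)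
  · intro x
    exact (continuousOn_mulVec hM continuousOn_const).add hG

end Existence

/-! ### Cauchy problems for the direct and the coupled equations. -/

section Cauchy

variable {n : ℕ} {A : ℝ → Matrix (Fin n) (Fin n) ℝ} {a b c : ℝ} {g h φ ψ z : ℝ → Fin n → ℝ}

theorem _root_.ContinuousOn.memLp_two_Ioo {E : Type*} [NormedAddCommGroup E]
    {f : ℝ → E} (hf : ContinuousOn f (Icc a b)) : MemLp f 2 (volume.restrict (Ioo a b)) := by
  obtain ⟨K, hK⟩ := isCompact_Icc.exists_bound_of_continuousOn hf
  refine MemLp.of_bound ((hf.mono Ioo_subset_Icc_self).aestronglyMeasurable measurableSet_Ioo) K ?_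
  filter_upwards [ae_restrict_mem measurableSet_Ioo] with t ht using hK t (Ioo_subset_Icc_self ht)

theorem primitive_of_hasDerivWithinAt {E : Type*} [NormedAddCommGroup E] [NormedSpace ℝ E]
    [CompleteSpace E] {x f : ℝ → E} (hf : ContinuousOn f (Icc a b))
    (hx : ∀ t ∈ Icc a b, HasDerivWithinAt x (f t) (Icc a b) t) :
    ∀ t ∈ Icc a b, x t = x a + ∫ τ in a..t, f τ := by
  intro t ht
  have hs : Icc a t ⊆ Icc a b := Icc_subset_Icc_right ht.2
  rw [intervalIntegral.integral_eq_sub_of_hasDerivAt_of_le ht.1 (f := x)]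
  · abel
  · exact fun τ hτ => ((hx τ (hs hτ)).continuousWithinAt).mono hs
  · intro τ hτ
    exact (hx τ (hs (Ioo_subset_Icc_self hτ))).hasDerivAt
      (Icc_mem_nhds hτ.1 (hτ.2.trans_le ht.2))
  · exact (hf.mono hs).intervalIntegrable_of_Icc ht.1

theorem solvesDirect_of_hasDerivWithinAt (hab : a ≤ b)
    (hA : ContinuousOn A (Icc a b)) (hg : ContinuousOn g (Icc a b))
    (hφ : ∀ t ∈ Icc a b, HasDerivWithinAt φ (g t - A t *ᵥ φ t) (Icc a b) t) :
    SolvesDirect A a b g φ := by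
  have hc : ContinuousOn (fun t => g t - A t *ᵥ φ t) (Icc a b) :=
    hg.sub (continuousOn_mulVec hA fun t ht => (hφ t ht).continuousWithinAt)
  exact solvesDirect_of_primitive hab hc.memLp_two_Ioo (primitive_of_hasDerivWithinAt hc hφ)

/-- The right-hand side is only $L^2$, so its primitive $G$ is subtracted: $y=\varphi-G$ satisfies
$y'=-Ay-AG$, which has continuous coefficients. -/
theorem exists_solvesDirect (hab : a ≤ b) (hA : ContinuousOn A (Icc a b))
    (hg : MemLp g 2 (volume.restrict (Ioo a b))) (v : Fin n → ℝ) :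
    ∃ φ, SolvesDirect A a b g φ ∧ φ a = v := by
  have hi := hg.intervalIntegrable_of_Ioo hab
  set G : ℝ → Fin n → ℝ := fun t => ∫ τ in a..t, g τ
  have hG : ContinuousOn G (Icc a b) := by
    have := intervalIntegral.continuousOn_primitive_interval' hi left_mem_uIcc
    rwa [uIcc_of_le hab] at this
  obtain ⟨y, hy, hd⟩ := exists_solution_matrix (M := fun t => -A t) (G := fun t => -(A t *ᵥ G t)) hab
    hA.neg (continuousOn_mulVec hA hG).neg v
  have hyc : ContinuousOn y (Icc a b) := fun t ht => (hd t ht).continuousWithinAt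
  have e : ∀ t, -A t *ᵥ y t + -(A t *ᵥ G t) = -(A t *ᵥ (y t + G t)) := fun t => by
    rw [Matrix.neg_mulVec, Matrix.mulVec_add, neg_add]
  simp only [e] at hd
  have hc : ContinuousOn (fun t => -(A t *ᵥ (y t + G t))) (Icc a b) :=
    (continuousOn_mulVec hA (hyc.add hG)).neg
  have hG0 : G a = 0 := intervalIntegral.integral_same
  refine ⟨fun t => y t + G t, solvesDirect_of_primitive hab ?_ fun t ht => ?_, ?_⟩
  · simp only [sub_eq_add_neg]
    exact hg.add hc.memLp_two_Ioo
  · have hs : Icc a t ⊆ Icc a b := Icc_subset_Icc_right ht.2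
    have hs' : uIcc a t ⊆ uIcc a b := by rwa [uIcc_of_le hab, uIcc_of_le ht.1]
    rw [primitive_of_hasDerivWithinAt hc hd t ht]
    simp only [sub_eq_add_neg]
    rw [intervalIntegral.integral_add (hi.mono_set hs')
      ((hc.mono hs).intervalIntegrable_of_Icc ht.1), hG0]
    abel
  · simp only [hy, hG0, add_zero]

/-- Cauchy problem for the coupled direct / adjoint equations. -/
theorem exists_solves_coupled {W R : ℝ → Matrix (Fin n) (Fin n) ℝ} (hab : a ≤ b)
    (hA : ContinuousOn A (Icc a b)) (hW : ContinuousOn W (Icc a b)) (hR : ContinuousOn R (Icc a b))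
    (v w : Fin n → ℝ) :
    ∃ z p, SolvesAdjoint A a b (fun t => -(W t *ᵥ p t)) z ∧
      SolvesDirect A a b (fun t => R t *ᵥ z t) p ∧ z a = v ∧ p a = w := by
  have hAt : ContinuousOn (fun t => (A t)ᵀ) (Icc a b) :=
    (Continuous.matrix_transpose continuous_id).comp_continuousOn hA
  -- The pair $(z,p)$ satisfies one linear system $z'=A^Tz+Wp$, $p'=Rz-Ap$.
  have hM : ContinuousOn (fun t => Matrix.fromBlocks (A t)ᵀ (W t) (R t) (-A t)) (Icc a b) := by
    have : Continuous fun q : (Matrix (Fin n) (Fin n) ℝ × Matrix (Fin n) (Fin n) ℝ) ×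
        (Matrix (Fin n) (Fin n) ℝ × Matrix (Fin n) (Fin n) ℝ) =>
        Matrix.fromBlocks q.1.1 q.1.2 q.2.1 q.2.2 :=
      Continuous.matrix_fromBlocks (by fun_prop) (by fun_prop) (by fun_prop) (by fun_prop)
    exact this.comp_continuousOn ((hAt.prodMk hW).prodMk (hR.prodMk hA.neg))
  obtain ⟨x, hx, hd⟩ := exists_solution_matrix
    (M := fun t => Matrix.fromBlocks (A t)ᵀ (W t) (R t) (-A t)) (G := fun _ => 0) hab
    hM continuousOn_const (Sum.elim v w)
  · have hxc : ContinuousOn x (Icc a b) := fun t ht => (hd t ht).continuousWithinAt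
    have hzc : ContinuousOn (fun t => x t ∘ Sum.inl) (Icc a b) :=
      continuousOn_pi.2 fun i => continuousOn_pi.1 hxc _
    have hpc : ContinuousOn (fun t => x t ∘ Sum.inr) (Icc a b) :=
      continuousOn_pi.2 fun i => continuousOn_pi.1 hxc _
    have e : ∀ t, Matrix.fromBlocks (A t)ᵀ (W t) (R t) (-A t) *ᵥ x t + 0
        = Sum.elim ((A t)ᵀ *ᵥ (x t ∘ Sum.inl) + W t *ᵥ (x t ∘ Sum.inr))
          (R t *ᵥ (x t ∘ Sum.inl) + -A t *ᵥ (x t ∘ Sum.inr)) := fun t => by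
      rw [add_zero, Matrix.fromBlocks_mulVec]
    simp only [e] at hd
    refine ⟨fun t => x t ∘ Sum.inl, fun t => x t ∘ Sum.inr, ?_, ?_, ?_, ?_⟩
    · rw [solvesAdjoint_iff]
      refine solvesDirect_of_hasDerivWithinAt hab hAt.neg
        (continuousOn_mulVec hW hpc).neg.neg fun t ht => ?_
      refine hasDerivWithinAt_pi.2 fun i => ?_
      refine (hasDerivWithinAt_pi.1 (hd t ht) (Sum.inl i)).congr_deriv (Eq.symm ?_)
      change (- -(W t *ᵥ (x t ∘ Sum.inr)) - -(A t)ᵀ *ᵥ (x t ∘ Sum.inl)) i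
        = ((A t)ᵀ *ᵥ (x t ∘ Sum.inl) + W t *ᵥ (x t ∘ Sum.inr)) i
      rw [Matrix.neg_mulVec, sub_neg_eq_add, neg_neg, add_comm]
    · refine solvesDirect_of_hasDerivWithinAt hab hA (continuousOn_mulVec hR hzc) fun t ht => ?_
      refine hasDerivWithinAt_pi.2 fun i => ?_
      refine (hasDerivWithinAt_pi.1 (hd t ht) (Sum.inr i)).congr_deriv (Eq.symm ?_)
      change (R t *ᵥ (x t ∘ Sum.inl) - A t *ᵥ (x t ∘ Sum.inr)) i
        = (R t *ᵥ (x t ∘ Sum.inl) + -A t *ᵥ (x t ∘ Sum.inr)) i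
      rw [Matrix.neg_mulVec, sub_eq_add_neg]
    · simp only [hx, Sum.elim_comp_inl]
    · simp only [hx, Sum.elim_comp_inr]

end Cauchy

end TwoPoint

namespace TwoPoint

/-- Relational form of `surjective_of_ker_le`. -/
theorem exists_left_of_linear_relation {E F : Type*} [AddCommGroup E]
    [Module ℝ E] [AddCommGroup F] [Module ℝ F] [FiniteDimensional ℝ E] [FiniteDimensional ℝ F]
    (hd : Module.finrank ℝ E = Module.finrank ℝ F) (S : Set (E × F)) (h0 : (0 : E × F) ∈ S)
    (hcomb : ∀ (k : ℝ) (x y : E × F), x ∈ S → y ∈ S → k • x + y ∈ S)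
    (hleft : ∀ e, ∃ f, (e, f) ∈ S) (hk : ∀ e, (e, (0 : F)) ∈ S → e = 0) (f : F) :
    ∃ e, (e, f) ∈ S := by
  let V : Submodule ℝ (E × F) :=
    { carrier := S
      zero_mem' := h0
      add_mem' := fun {x y} hx hy => by simpa using hcomb 1 x y hx hy
      smul_mem' := fun k x hx => by simpa using hcomb k x 0 hx h0 }
  have := surjective_of_ker_le hd (LinearMap.fst ℝ E F ∘ₗ V.subtype)
    (LinearMap.snd ℝ E F ∘ₗ V.subtype)
    (fun e => by obtain ⟨f, hf⟩ := hleft e; exact ⟨⟨(e, f), hf⟩, rfl⟩)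
    (fun x hx => by
      obtain ⟨⟨e, f⟩, hx'⟩ := x
      have hf : f = 0 := hx
      subst hf
      exact hk e hx')
  obtain ⟨⟨⟨e, f'⟩, hx⟩, rfl⟩ := this f
  exact ⟨e, hx⟩

/-! ### Square-integrable vector functions and integrals of quadratic forms. -/

section Integrals

theorem ae_Ioo_of_forall {p : ℝ → Prop} {a b : ℝ} (h : ∀ t ∈ Ioo a b, p t) :
    ∀ᵐ t ∂volume.restrict (Ioo a b), p t := by
  filter_upwards [ae_restrict_mem measurableSet_Ioo] with t ht using h t ht

theorem integral_congr_ae_Ioo {f g : ℝ → ℝ} {a b : ℝ} (hab : a ≤ b)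
    (h : ∀ᵐ t ∂volume.restrict (Ioo a b), f t = g t) : ∫ t in a..b, f t = ∫ t in a..b, g t := by
  rw [intervalIntegral.integral_of_le hab, intervalIntegral.integral_of_le hab,
    integral_Ioc_eq_integral_Ioo, integral_Ioc_eq_integral_Ioo]
  exact integral_congr_ae h

theorem integral_eq_integral_Ioo {f : ℝ → ℝ} {a b : ℝ} (hab : a ≤ b) :
    ∫ t in a..b, f t = ∫ t in Ioo a b, f t := by
  rw [intervalIntegral.integral_of_le hab, integral_Ioc_eq_integral_Ioo]

theorem integrable_dotProduct {Ω k : Type*} [Fintype k] {mΩ : MeasurableSpace Ω} {μ : Measure Ω}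
    {f g : Ω → k → ℝ} (hf : MemLp f 2 μ) (hg : MemLp g 2 μ) :
    Integrable (fun t => f t ⬝ᵥ g t) μ :=
  integrable_finsetSum _ fun i _ => (hf.eval i).integrable_mul (hg.eval i)

theorem intervalIntegrable_dotProduct {k : Type*} [Fintype k] {f g : ℝ → k → ℝ} {a b : ℝ}
    (hab : a ≤ b) (hf : MemLp f 2 (volume.restrict (Ioo a b)))
    (hg : MemLp g 2 (volume.restrict (Ioo a b))) :
    IntervalIntegrable (fun t => f t ⬝ᵥ g t) volume a b := by
  rw [intervalIntegrable_iff_integrableOn_Ioo_of_le hab]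
  exact integrable_dotProduct hf hg

theorem memLp_mulVec_of_bound {Ω k k' : Type*} [Fintype k] [Fintype k'] {mΩ : MeasurableSpace Ω}
    {μ : Measure Ω} {M : Ω → Matrix k' k ℝ} {f : Ω → k → ℝ}
    (hM : ∀ i j, AEStronglyMeasurable (fun x => M x i j) μ)
    (hb : ∀ i j, ∃ K : ℝ, ∀ᵐ x ∂μ, ‖M x i j‖ ≤ K) (hf : MemLp f 2 μ) :
    MemLp (fun x => M x *ᵥ f x) 2 μ := by
  refine memLp_pi_iff.2 fun i => memLp_finsetSum _ fun j _ => ?_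
  obtain ⟨K, hK⟩ := hb i j
  refine (hf.eval j).of_le_mul (c := K) ((hM i j).mul (hf.eval j).aestronglyMeasurable) ?_
  filter_upwards [hK] with x hx
  rw [norm_mul]
  gcongr

theorem _root_.ContinuousOn.aestronglyMeasurable_entry {k k' : Type*} {M : ℝ → Matrix k' k ℝ}
    {a b : ℝ} (hM : ContinuousOn M (Icc a b)) (i : k') (j : k) :
    AEStronglyMeasurable (fun t => M t i j) (volume.restrict (Ioo a b)) :=
  (((continuous_apply_apply i j).comp_continuousOn hM).mono
    Ioo_subset_Icc_self).aestronglyMeasurable measurableSet_Ioo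

theorem _root_.ContinuousOn.exists_bound_entry {k k' : Type*} {M : ℝ → Matrix k' k ℝ}
    {a b : ℝ} (hM : ContinuousOn M (Icc a b)) (i : k') (j : k) :
    ∃ K : ℝ, ∀ᵐ t ∂volume.restrict (Ioo a b), ‖M t i j‖ ≤ K := by
  have hc : ContinuousOn (fun t => M t i j) (Icc a b) :=
    (continuous_apply_apply i j).comp_continuousOn hM
  obtain ⟨K, hK⟩ := isCompact_Icc.exists_bound_of_continuousOn hc
  exact ⟨K, ae_Ioo_of_forall fun t ht => hK t (Ioo_subset_Icc_self ht)⟩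

/-- Multiplication by a matrix that is continuous on a compact interval preserves `L²`. -/
theorem memLp_mulVec {k k' : Type*} [Fintype k] [Fintype k'] {M : ℝ → Matrix k' k ℝ}
    {f : ℝ → k → ℝ} {a b : ℝ}
    (hM : ContinuousOn M (Icc a b)) (hf : MemLp f 2 (volume.restrict (Ioo a b))) :
    MemLp (fun t => M t *ᵥ f t) 2 (volume.restrict (Ioo a b)) :=
  memLp_mulVec_of_bound hM.aestronglyMeasurable_entry hM.exists_bound_entry hf

theorem dotProduct_transpose_mulVec {k k' : Type*} [Fintype k] [Fintype k'] (M : Matrix k' k ℝ)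
    (x : k' → ℝ) (y : k → ℝ) : (Mᵀ *ᵥ x) ⬝ᵥ y = x ⬝ᵥ (M *ᵥ y) := by
  rw [Matrix.mulVec_transpose, Matrix.dotProduct_mulVec]

theorem eqOn_zero_of_ae_Ioo {E : Type*} [TopologicalSpace E] [T2Space E] [Zero E] {f : ℝ → E}
    {a b : ℝ} (hab : a < b)
    (hf : ContinuousOn f (Icc a b)) (h : ∀ᵐ t ∂volume.restrict (Ioo a b), f t = 0) :
    ∀ t ∈ Icc a b, f t = 0 := by
  have h1 : EqOn f (fun _ => 0) (Ioo a b) := by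
    refine Measure.eqOn_open_of_ae_eq h isOpen_Ioo (hf.mono Ioo_subset_Icc_self) continuousOn_const
  have h2 := h1.of_subset_closure hf continuousOn_const Ioo_subset_Icc_self
    (by rw [closure_Ioo hab.ne])
  exact h2

theorem ae_eq_zero_of_posDef {k : Type*} [Fintype k] {M : ℝ → Matrix k k ℝ} {f : ℝ → k → ℝ}
    {a b : ℝ} (hab : a ≤ b)
    (hM : ∀ t ∈ Icc a b, (M t).PosDef) (hi : IntervalIntegrable (fun t => (M t *ᵥ f t) ⬝ᵥ f t) volume a b)
    (h : ∫ t in a..b, (M t *ᵥ f t) ⬝ᵥ f t ≤ 0) : ∀ᵐ t ∂volume.restrict (Ioo a b), f t = 0 := by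
  rw [integral_eq_integral_Ioo hab] at h
  have h0 : 0 ≤ᵐ[volume.restrict (Ioo a b)] fun t => (M t *ᵥ f t) ⬝ᵥ f t :=
    ae_Ioo_of_forall fun t ht => posDef_mulVec_dotProduct_nonneg (hM t (Ioo_subset_Icc_self ht)) _
  have h1 := (integral_eq_zero_iff_of_nonneg_ae h0
    ((intervalIntegrable_iff_integrableOn_Ioo_of_le hab).1 hi)).1
    (le_antisymm h (integral_nonneg_of_ae h0))
  filter_upwards [h1, ae_restrict_mem measurableSet_Ioo] with t ht hm
  exact posDef_eq_zero (hM t (Ioo_subset_Icc_self hm)) ht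

theorem integral_posDef_nonneg {k : Type*} [Fintype k] {M : ℝ → Matrix k k ℝ} {f : ℝ → k → ℝ}
    {a b : ℝ} (hab : a ≤ b) (hM : ∀ t ∈ Icc a b, (M t).PosDef) :
    0 ≤ ∫ t in a..b, (M t *ᵥ f t) ⬝ᵥ f t :=
  intervalIntegral.integral_nonneg hab fun t ht => posDef_mulVec_dotProduct_nonneg (hM t ht) _

end Integrals

theorem SolvesDirect.mono {n : ℕ} {A : ℝ → Matrix (Fin n) (Fin n) ℝ} {a b c d : ℝ}
    {g φ : ℝ → Fin n → ℝ} (h : SolvesDirect A a b g φ) (hac : a ≤ c) (hcd : c ≤ d) (hdb : d ≤ b) :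
    SolvesDirect A c d g φ := by
  have hm : (volume : Measure ℝ).restrict (Ioo c d) ≤ volume.restrict (Ioo a b) :=
    Measure.restrict_mono (Ioo_subset_Ioo hac hdb) le_rfl
  refine ⟨fun i => ⟨(h.1 i).1.mono ?_, (h.1 i).2.mono_measure hm⟩, ae_mono hm h.2⟩
  rw [uIcc_of_le hcd, uIcc_of_le (hac.trans (hcd.trans hdb))]
  exact Icc_subset_Icc hac hdb

theorem solvesDirect_zero {n : ℕ} (A : ℝ → Matrix (Fin n) (Fin n) ℝ) {a b : ℝ} (hab : a ≤ b) :
    SolvesDirect A a b (fun _ => 0) (fun _ => 0) := by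
  refine solvesDirect_of_primitive hab ?_ ?_
  · simp
  · simp

/-! ### Standing assumptions and solvability of the boundary value problem. -/

namespace Data

variable {n m l : ℕ} {D : Data n m l}

/-- The standing assumptions of the estimation problem. -/
structure Regular (D : Data n m l) : Prop where
  α_nonneg : 0 ≤ D.α
  s_mem : D.s ∈ Ioo D.α D.β
  β_le : D.β ≤ D.T
  continuousOn_A : ContinuousOn D.A (Icc 0 D.T)
  continuousOn_H : ContinuousOn D.H (Icc D.α D.β)
  det₀ : (selectedCols D.e₀ D.B₀).det ≠ 0
  det₁ : (selectedCols D.e₁ D.B₁).det ≠ 0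
  eq_zero_of_solvesBVP : ∀ φ : ℝ → Fin n → ℝ, D.SolvesBVP 0 0 (fun _ => 0) φ →
    ∀ t ∈ Icc 0 D.T, φ t = 0
  continuousOn_Q : ContinuousOn D.Q (Icc D.α D.β)
  posDef_Q : ∀ t ∈ Icc D.α D.β, (D.Q t).PosDef
  posDef_Q₀ : D.Q₀.PosDef
  posDef_Q₁ : D.Q₁.PosDef
  continuousOn_Q₂ : ContinuousOn D.Q₂ (Icc 0 D.T)
  posDef_Q₂ : ∀ t ∈ Icc 0 D.T, (D.Q₂ t).PosDef
  memLp_fc : MemLp D.fc 2 (volume.restrict (Ioo 0 D.T))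

namespace Regular

theorem α_lt_β (hD : D.Regular) : D.α < D.β := hD.s_mem.1.trans hD.s_mem.2
theorem T_nonneg (hD : D.Regular) : 0 ≤ D.T := hD.α_nonneg.trans (hD.α_lt_β.le.trans hD.β_le)
theorem Icc_subset (hD : D.Regular) : Icc D.α D.β ⊆ Icc 0 D.T := Icc_subset_Icc hD.α_nonneg hD.β_le

/-- Fredholm alternative by counting. The right-hand side is scaled by a parameter $k$, which is
counted among both the unknowns and the conditions; this makes the affine problem linear, and the
case $k=1$ is the one wanted. -/
theorem exists_solvesBVP (hD : D.Regular) (f₀ : Fin m → ℝ) (f₁ : Fin (n - m) → ℝ)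
    {f : ℝ → Fin n → ℝ} (hf : MemLp f 2 (volume.restrict (Ioo 0 D.T))) :
    ∃ φ, D.SolvesBVP f₀ f₁ f φ := by
  have hT := hD.T_nonneg
  have hmn : m + (n - m) = n := by simpa using Fintype.card_congr D.e₀
  obtain ⟨⟨k, v⟩, φ, hφ, h1, h2, h3, h4⟩ := exists_left_of_linear_relation
    (E := ℝ × (Fin n → ℝ)) (F := ℝ × (Fin m → ℝ) × (Fin (n - m) → ℝ))
    (by simp [hmn])
    {x | ∃ φ, SolvesDirect D.A 0 D.T (fun t => x.1.1 • f t) φ ∧ φ 0 = x.1.2 ∧ x.2.1 = x.1.1 ∧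
      x.2.2.1 = D.B₀ *ᵥ φ 0 ∧ x.2.2.2 = D.B₁ *ᵥ φ D.T}
    ⟨fun _ => 0, by simpa using solvesDirect_zero D.A hT, by simp⟩
    (by
      rintro k ⟨⟨a, b⟩, c, d, e⟩ ⟨⟨a', b'⟩, c', d', e'⟩ ⟨φ, hφ, h1, h2, h3, h4⟩
        ⟨φ', hφ', h1', h2', h3', h4'⟩
      refine ⟨_, (hφ.linear_comb hT k hφ').congr hT (fun _ _ => rfl) ?_, ?_⟩
      · exact Filter.Eventually.of_forall fun t => by simp [add_smul, mul_smul]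
      · simp_all [Matrix.mulVec_add, Matrix.mulVec_smul])
    (by
      rintro ⟨k, v⟩
      obtain ⟨φ, hφ, h0⟩ := exists_solvesDirect hT hD.continuousOn_A (hf.const_smul k) v
      exact ⟨(k, D.B₀ *ᵥ φ 0, D.B₁ *ᵥ φ D.T), φ, hφ, h0, rfl, rfl, rfl⟩)
    (by
      rintro ⟨k, v⟩ ⟨φ, hφ, h1, h2, h3, h4⟩
      simp only [Prod.fst_zero, Prod.snd_zero] at h1 h2 h3 h4
      have := hD.eq_zero_of_solvesBVP φ ⟨by simpa [← h2] using hφ, h3.symm, h4.symm⟩ 0 ⟨le_rfl, hT⟩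
      rw [Prod.mk_eq_zero]
      exact ⟨h2.symm, by rw [← h1, this]⟩)
    (1, f₀, f₁)
  simp only at h2 h3 h4 hφ
  exact ⟨φ, by simpa [← h2] using hφ, h3.symm, h4.symm⟩

end Regular

end Data

end TwoPoint

/-! ### The coupled system, separated into propagation and boundary conditions. -/

namespace TwoPoint

/-- The linear combination `k w + w'`. -/
def Pieces.comb {n : ℕ} (k : ℝ) (w w' : Pieces n) : Pieces n where
  z₁ t := k • w.z₁ t + w'.z₁ t
  z₂ t := k • w.z₂ t + w'.z₂ t
  z₃ t := k • w.z₃ t + w'.z₃ t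
  z₄ t := k • w.z₄ t + w'.z₄ t
  p₁ t := k • w.p₁ t + w'.p₁ t
  p₂ t := k • w.p₂ t + w'.p₂ t
  p₃ t := k • w.p₃ t + w'.p₃ t
  p₄ t := k • w.p₄ t + w'.p₄ t

namespace Data

variable {n m l : ℕ} {D : Data n m l} {j j' : Fin n → ℝ} {w w' : Pieces n}

/-- The matrix `Hᵀ Q H`. -/
def gram (D : Data n m l) (t : ℝ) : Matrix (Fin n) (Fin n) ℝ := (D.H t)ᵀ * (D.Q t * D.H t)

theorem gram_mulVec (D : Data n m l) (t : ℝ) (x : Fin n → ℝ) :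
    D.gram t *ᵥ x = (D.H t)ᵀ *ᵥ (D.Q t *ᵥ (D.H t *ᵥ x)) := by
  simp [gram, Matrix.mulVec_mulVec]

/-- The differential equations and the matching conditions of the coupled system, with an arbitrary
jump `j` of the adjoint variable at `s`, without the boundary conditions at `0` and `T`. -/
structure Propagates (D : Data n m l) (j : Fin n → ℝ) (w : Pieces n) : Prop where
  z₁_eq : SolvesAdjoint D.A 0 D.α (fun _ => 0) w.z₁
  z₂_eq : SolvesAdjoint D.A D.α D.s (fun t => -(D.gram t *ᵥ w.p₂ t)) w.z₂
  z₂_left : w.z₂ D.α = w.z₁ D.α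
  z₃_eq : SolvesAdjoint D.A D.s D.β (fun t => -(D.gram t *ᵥ w.p₃ t)) w.z₃
  z₃_left : w.z₃ D.s = w.z₂ D.s - j
  z₄_eq : SolvesAdjoint D.A D.β D.T (fun _ => 0) w.z₄
  z₄_left : w.z₄ D.β = w.z₃ D.β
  p₁_eq : SolvesDirect D.A 0 D.α (fun t => (D.Q₂ t)⁻¹ *ᵥ w.z₁ t) w.p₁
  p₂_eq : SolvesDirect D.A D.α D.s (fun t => (D.Q₂ t)⁻¹ *ᵥ w.z₂ t) w.p₂
  p₂_left : w.p₂ D.α = w.p₁ D.α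
  p₃_eq : SolvesDirect D.A D.s D.β (fun t => (D.Q₂ t)⁻¹ *ᵥ w.z₃ t) w.p₃
  p₃_left : w.p₃ D.s = w.p₂ D.s
  p₄_eq : SolvesDirect D.A D.β D.T (fun t => (D.Q₂ t)⁻¹ *ᵥ w.z₄ t) w.p₄
  p₄_left : w.p₄ D.β = w.p₃ D.β

/-- The boundary conditions of the coupled system. -/
structure BoundaryConditions (D : Data n m l) (w : Pieces n) : Prop where
  z₁_zero : D.B₀hat *ᵥ w.z₁ 0 = 0
  z₄_end : D.B₁hat *ᵥ w.z₄ D.T = 0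
  p₁_zero : D.B₀ *ᵥ w.p₁ 0 = D.Q₀⁻¹ *ᵥ (D.B₀bar *ᵥ w.z₁ 0)
  p₄_end : D.B₁ *ᵥ w.p₄ D.T = -(D.Q₁⁻¹ *ᵥ (D.B₁bar *ᵥ w.z₄ D.T))

theorem solvesSystem_iff : D.SolvesSystem w ↔ D.Propagates D.a w ∧ D.BoundaryConditions w := by
  constructor
  · intro h
    refine ⟨⟨h.z₁_eq, ?_, h.z₂_left, ?_, h.z₃_left, h.z₄_eq, h.z₄_left, h.p₁_eq, h.p₂_eq,
      h.p₂_left, h.p₃_eq, h.p₃_left, h.p₄_eq, h.p₄_left⟩,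
      ⟨h.z₁_zero, h.z₄_end, h.p₁_zero, h.p₄_end⟩⟩
    · simp only [gram_mulVec]; exact h.z₂_eq
    · simp only [gram_mulVec]; exact h.z₃_eq
  · rintro ⟨h, b⟩
    have h2 := h.z₂_eq
    have h3 := h.z₃_eq
    simp only [gram_mulVec] at h2 h3
    exact ⟨h.z₁_eq, b.z₁_zero, h2, h.z₂_left, h3, h.z₃_left, h.z₄_eq, h.z₄_left, b.z₄_end, h.p₁_eq,
      b.p₁_zero, h.p₂_eq, h.p₂_left, h.p₃_eq, h.p₃_left, h.p₄_eq, h.p₄_left, b.p₄_end⟩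

theorem Propagates.comb (hD : D.Regular) (k : ℝ) (h : D.Propagates j w) (h' : D.Propagates j' w') :
    D.Propagates (k • j + j') (w.comb k w') := by
  have i1 := hD.α_nonneg
  have i2 := hD.s_mem.1.le
  have i3 := hD.s_mem.2.le
  have i4 := hD.β_le
  refine ⟨?_, ?_, ?_, ?_, ?_, ?_, ?_, ?_, ?_, ?_, ?_, ?_, ?_, ?_⟩
  · simpa using! h.z₁_eq.linear_comb i1 k h'.z₁_eq
  · convert! h.z₂_eq.linear_comb i2 k h'.z₂_eq using 2 with t
    simp only [Pieces.comb, Matrix.mulVec_add, Matrix.mulVec_smul, smul_neg, neg_add]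
  · simp [Pieces.comb, h.z₂_left, h'.z₂_left]
  · convert! h.z₃_eq.linear_comb i3 k h'.z₃_eq using 2 with t
    simp only [Pieces.comb, Matrix.mulVec_add, Matrix.mulVec_smul, smul_neg, neg_add]
  · simp only [Pieces.comb, h.z₃_left, h'.z₃_left, smul_sub]; abel
  · simpa using! h.z₄_eq.linear_comb i4 k h'.z₄_eq
  · simp [Pieces.comb, h.z₄_left, h'.z₄_left]
  · convert! h.p₁_eq.linear_comb i1 k h'.p₁_eq using 2 with t
    simp only [Pieces.comb, Matrix.mulVec_add, Matrix.mulVec_smul]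
  · convert! h.p₂_eq.linear_comb i2 k h'.p₂_eq using 2 with t
    simp only [Pieces.comb, Matrix.mulVec_add, Matrix.mulVec_smul]
  · simp [Pieces.comb, h.p₂_left, h'.p₂_left]
  · convert! h.p₃_eq.linear_comb i3 k h'.p₃_eq using 2 with t
    simp only [Pieces.comb, Matrix.mulVec_add, Matrix.mulVec_smul]
  · simp [Pieces.comb, h.p₃_left, h'.p₃_left]
  · convert! h.p₄_eq.linear_comb i4 k h'.p₄_eq using 2 with t
    simp only [Pieces.comb, Matrix.mulVec_add, Matrix.mulVec_smul]
  · simp [Pieces.comb, h.p₄_left, h'.p₄_left]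

/-- The function glued from `p₁, p₂, p₃, p₄`. -/
noncomputable def state (D : Data n m l) (w : Pieces n) (t : ℝ) : Fin n → ℝ :=
  if t < D.α then w.p₁ t else if t < D.s then w.p₂ t else if t < D.β then w.p₃ t else w.p₄ t

/-- The optimal weight, on the whole interval `(α, β)`. -/
noncomputable def weight (D : Data n m l) (w : Pieces n) (t : ℝ) : Fin l → ℝ :=
  D.Q t *ᵥ (D.H t *ᵥ D.state w t)

/-! ### Gluing the four pieces; Green's identity on the whole interval. -/

section Glue

variable (hD : D.Regular)
include hD

omit hD in
theorem glued_eqOn₁ (w : Pieces n) : EqOn (D.glued w) w.z₁ (Ioo 0 D.α) := fun _ ht => if_pos ht.2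

omit hD in
theorem glued_eqOn₂ (w : Pieces n) : EqOn (D.glued w) w.z₂ (Ioo D.α D.s) := fun t ht => by
  simp only [glued]; rw [if_neg (not_lt.2 ht.1.le), if_pos ht.2]

theorem glued_eqOn₃ (w : Pieces n) : EqOn (D.glued w) w.z₃ (Ioo D.s D.β) := fun t ht => by
  have := hD.s_mem.1
  simp only [glued]
  rw [if_neg (not_lt.2 (this.trans ht.1).le), if_neg (not_lt.2 ht.1.le), if_pos ht.2]

theorem glued_eqOn₄ (w : Pieces n) : EqOn (D.glued w) w.z₄ (Ioo D.β D.T) := fun t ht => by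
  have := hD.s_mem.1
  have := hD.s_mem.2
  simp only [glued]
  rw [if_neg (by linarith [ht.1]), if_neg (by linarith [ht.1]), if_neg (by linarith [ht.1])]

/-- The matching conditions for $p$ give agreement at the nodes as well. For $z$, which jumps at
$s$, only open intervals are used. -/
theorem Propagates.state_eqOn₁ (h : D.Propagates j w) : EqOn (D.state w) w.p₁ (Icc 0 D.α) := by
  intro t ht
  simp only [state]
  rcases eq_or_lt_of_le ht.2 with h1 | h1
  · rw [h1, if_neg (lt_irrefl _), if_pos hD.s_mem.1, h.p₂_left]
  · rw [if_pos h1]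

theorem Propagates.state_eqOn₂ (h : D.Propagates j w) : EqOn (D.state w) w.p₂ (Icc D.α D.s) := by
  intro t ht
  simp only [state]
  rw [if_neg (not_lt.2 ht.1)]
  rcases eq_or_lt_of_le ht.2 with h1 | h1
  · rw [h1, if_neg (lt_irrefl _), if_pos hD.s_mem.2, h.p₃_left]
  · rw [if_pos h1]

theorem Propagates.state_eqOn₃ (h : D.Propagates j w) : EqOn (D.state w) w.p₃ (Icc D.s D.β) := by
  intro t ht
  simp only [state]
  rw [if_neg (not_lt.2 (hD.s_mem.1.le.trans ht.1)), if_neg (not_lt.2 ht.1)]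
  rcases eq_or_lt_of_le ht.2 with h1 | h1
  · rw [h1, if_neg (lt_irrefl _), h.p₄_left]
  · rw [if_pos h1]

theorem state_eqOn₄ (w : Pieces n) : EqOn (D.state w) w.p₄ (Icc D.β D.T) := by
  intro t ht
  have := hD.s_mem.1
  have := hD.s_mem.2
  simp only [state]
  rw [if_neg (by linarith [ht.1]), if_neg (by linarith [ht.1]), if_neg (by linarith [ht.1])]

theorem Propagates.solvesDirect_state (h : D.Propagates j w) :
    SolvesDirect D.A 0 D.T (fun t => (D.Q₂ t)⁻¹ *ᵥ D.glued w t) (D.state w) := by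
  have i1 := hD.α_nonneg
  have i2 := hD.s_mem.1.le
  have i3 := hD.s_mem.2.le
  have i4 := hD.β_le
  refine SolvesDirect.glue (i1.trans (i2.trans i3)) i4 (SolvesDirect.glue (i1.trans i2) i3
    (SolvesDirect.glue i1 i2 ?_ ?_) ?_) ?_
  · exact h.p₁_eq.congr i1 (h.state_eqOn₁ hD) (ae_Ioo_of_forall fun t ht => by
      simp only [glued_eqOn₁ w ht])
  · exact h.p₂_eq.congr i2 (h.state_eqOn₂ hD) (ae_Ioo_of_forall fun t ht => by
      simp only [glued_eqOn₂ w ht])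
  · exact h.p₃_eq.congr i3 (h.state_eqOn₃ hD) (ae_Ioo_of_forall fun t ht => by
      simp only [glued_eqOn₃ hD w ht])
  · exact h.p₄_eq.congr i4 (state_eqOn₄ hD w) (ae_Ioo_of_forall fun t ht => by
      simp only [glued_eqOn₄ hD w ht])

theorem Propagates.continuousOn_state (h : D.Propagates j w) :
    ContinuousOn (D.state w) (Icc 0 D.T) :=
  (h.solvesDirect_state hD).continuousOn hD.T_nonneg

theorem Propagates.continuousOn_observed (h : D.Propagates j w) :
    ContinuousOn (fun t => D.H t *ᵥ D.state w t) (Icc D.α D.β) :=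
  continuousOn_mulVec hD.continuousOn_H ((h.continuousOn_state hD).mono hD.Icc_subset)

theorem Propagates.continuousOn_weight (h : D.Propagates j w) :
    ContinuousOn (D.weight w) (Icc D.α D.β) :=
  continuousOn_mulVec hD.continuousOn_Q (h.continuousOn_observed hD)

theorem Propagates.memLp_glued (h : D.Propagates j w) :
    MemLp (D.glued w) 2 (volume.restrict (Ioo 0 D.T)) := by
  have i1 := hD.α_nonneg
  have i2 := hD.s_mem.1.le
  have i3 := hD.s_mem.2.le
  have i4 := hD.β_le
  refine memLp_Ioo_glue (b := D.β) (memLp_Ioo_glue (b := D.s) (memLp_Ioo_glue (b := D.α) ?_ ?_) ?_) ?_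
  · exact (h.z₁_eq.continuousOn i1).memLp_two_Ioo.ae_eq
      (ae_Ioo_of_forall fun t ht => (glued_eqOn₁ w ht).symm)
  · exact (h.z₂_eq.continuousOn i2).memLp_two_Ioo.ae_eq
      (ae_Ioo_of_forall fun t ht => (glued_eqOn₂ w ht).symm)
  · exact (h.z₃_eq.continuousOn i3).memLp_two_Ioo.ae_eq
      (ae_Ioo_of_forall fun t ht => (glued_eqOn₃ hD w ht).symm)
  · exact (h.z₄_eq.continuousOn i4).memLp_two_Ioo.ae_eq
      (ae_Ioo_of_forall fun t ht => (glued_eqOn₄ hD w ht).symm)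

theorem continuousOn_Q₂_inv : ContinuousOn (fun t => (D.Q₂ t)⁻¹) (Icc 0 D.T) :=
  continuousOn_matrix_inv hD.continuousOn_Q₂ hD.posDef_Q₂

theorem Propagates.memLp_Q₂_inv_glued (h : D.Propagates j w) :
    MemLp (fun t => (D.Q₂ t)⁻¹ *ᵥ D.glued w t) 2 (volume.restrict (Ioo 0 D.T)) :=
  memLp_mulVec (continuousOn_Q₂_inv hD) (h.memLp_glued hD)

/-- Green's identity for the whole chain. -/
theorem Propagates.green (h : D.Propagates j w) {f φ : ℝ → Fin n → ℝ}
    (hf : MemLp f 2 (volume.restrict (Ioo 0 D.T))) (hφ : SolvesDirect D.A 0 D.T f φ) :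
    w.z₄ D.T ⬝ᵥ φ D.T - w.z₁ 0 ⬝ᵥ φ 0 + j ⬝ᵥ φ D.s
      = (∫ t in (0 : ℝ)..D.T, D.glued w t ⬝ᵥ f t)
        + ∫ t in D.α..D.β, D.weight w t ⬝ᵥ (D.H t *ᵥ φ t) := by
  have i1 := hD.α_nonneg
  have i2 := hD.s_mem.1.le
  have i3 := hD.s_mem.2.le
  have i4 := hD.β_le
  have hI := intervalIntegrable_dotProduct hD.T_nonneg (h.memLp_glued hD) hf
  have hs : ∀ {x y : ℝ}, 0 ≤ x → x ≤ y → y ≤ D.T →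
      IntervalIntegrable (fun t => D.glued w t ⬝ᵥ f t) volume x y := fun {x y} h1 h2 h3 => by
    refine hI.mono_set ?_
    rw [uIcc_of_le h2, uIcc_of_le (h1.trans (h2.trans h3))]
    exact Icc_subset_Icc h1 h3
  have hJc : ContinuousOn (fun t => D.weight w t ⬝ᵥ (D.H t *ᵥ φ t)) (Icc D.α D.β) :=
    continuousOn_dotProduct (h.continuousOn_weight hD) (continuousOn_mulVec hD.continuousOn_H
      ((hφ.continuousOn hD.T_nonneg).mono hD.Icc_subset))
  have hJ : ∀ {x y : ℝ}, D.α ≤ x → x ≤ y → y ≤ D.β →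
      IntervalIntegrable (fun t => D.weight w t ⬝ᵥ (D.H t *ᵥ φ t)) volume x y :=
    fun {x y} h1 h2 h3 => (hJc.mono (Icc_subset_Icc h1 h3)).intervalIntegrable_of_Icc h2
  have g1 := TwoPoint.green i1 (hφ.mono le_rfl i1 (by linarith)) h.z₁_eq
  have g2 := TwoPoint.green i2 (hφ.mono i1 i2 (by linarith)) h.z₂_eq
  have g3 := TwoPoint.green i3 (hφ.mono (by linarith) i3 i4) h.z₃_eq
  have g4 := TwoPoint.green i4 (hφ.mono (by linarith) i4 le_rfl) h.z₄_eq
  have e1 : ∫ t in (0 : ℝ)..D.α, (w.z₁ t ⬝ᵥ f t - 0 ⬝ᵥ φ t)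
      = ∫ t in (0 : ℝ)..D.α, D.glued w t ⬝ᵥ f t :=
    integral_congr_ae_Ioo i1 (ae_Ioo_of_forall fun t ht => by
      rw [glued_eqOn₁ w ht, zero_dotProduct, sub_zero])
  have e4 : ∫ t in D.β..D.T, (w.z₄ t ⬝ᵥ f t - 0 ⬝ᵥ φ t)
      = ∫ t in D.β..D.T, D.glued w t ⬝ᵥ f t :=
    integral_congr_ae_Ioo i4 (ae_Ioo_of_forall fun t ht => by
      rw [glued_eqOn₄ hD w ht, zero_dotProduct, sub_zero])
  have e2 : ∫ t in D.α..D.s, (w.z₂ t ⬝ᵥ f t - (-(D.gram t *ᵥ w.p₂ t)) ⬝ᵥ φ t)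
      = ∫ t in D.α..D.s, (D.glued w t ⬝ᵥ f t + D.weight w t ⬝ᵥ (D.H t *ᵥ φ t)) :=
    integral_congr_ae_Ioo i2 (ae_Ioo_of_forall fun t ht => by
      rw [glued_eqOn₂ w ht, weight, h.state_eqOn₂ hD (Ioo_subset_Icc_self ht), gram_mulVec,
        neg_dotProduct, sub_neg_eq_add, dotProduct_transpose_mulVec])
  have e3 : ∫ t in D.s..D.β, (w.z₃ t ⬝ᵥ f t - (-(D.gram t *ᵥ w.p₃ t)) ⬝ᵥ φ t)
      = ∫ t in D.s..D.β, (D.glued w t ⬝ᵥ f t + D.weight w t ⬝ᵥ (D.H t *ᵥ φ t)) :=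
    integral_congr_ae_Ioo i3 (ae_Ioo_of_forall fun t ht => by
      rw [glued_eqOn₃ hD w ht, weight, h.state_eqOn₃ hD (Ioo_subset_Icc_self ht), gram_mulVec,
        neg_dotProduct, sub_neg_eq_add, dotProduct_transpose_mulVec])
  rw [e1] at g1
  rw [e2, intervalIntegral.integral_add (hs i1 i2 (by linarith)) (hJ le_rfl i2 i3)] at g2
  rw [e3, intervalIntegral.integral_add (hs (by linarith) i3 i4) (hJ i2 i3 le_rfl)] at g3
  rw [e4] at g4
  have s1 := intervalIntegral.integral_add_adjacent_intervals (hs le_rfl i1 (by linarith))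
    (hs i1 i2 (by linarith))
  have s2 := intervalIntegral.integral_add_adjacent_intervals
    (hs le_rfl (i1.trans i2) (by linarith)) (hs (by linarith) i3 i4)
  have s3 := intervalIntegral.integral_add_adjacent_intervals
    (hs le_rfl (i1.trans (i2.trans i3)) i4) (hs (by linarith) i4 le_rfl)
  have s4 := intervalIntegral.integral_add_adjacent_intervals (hJ le_rfl i2 i3) (hJ i2 i3 le_rfl)
  -- The boundary terms telescope at $\alpha$ and $\beta$; at $s$ the jump of $z$ leaves
  -- $(j,\varphi(s))$.
  rw [h.z₂_left] at g2
  rw [h.z₃_left, sub_dotProduct] at g3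
  rw [h.z₄_left] at g4
  linarith

end Glue

/-- The linear functional of the data of the boundary value problem which represents the estimation
error of the optimal weight. -/
noncomputable def functional (D : Data n m l) (w : Pieces n) (f₀ : Fin m → ℝ) (f₁ : Fin (n - m) → ℝ)
    (f : ℝ → Fin n → ℝ) : ℝ :=
  (D.B₀bar *ᵥ w.z₁ 0) ⬝ᵥ f₀ - (D.B₁bar *ᵥ w.z₄ D.T) ⬝ᵥ f₁ + ∫ t in (0 : ℝ)..D.T, D.glued w t ⬝ᵥ f t

/-- Largest squared deviation of the data over the ellipsoid. -/
noncomputable def dataError (D : Data n m l) (w : Pieces n) : ℝ :=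
  D.functional w (D.Q₀⁻¹ *ᵥ (D.B₀bar *ᵥ w.z₁ 0)) (-(D.Q₁⁻¹ *ᵥ (D.B₁bar *ᵥ w.z₄ D.T)))
    (fun t => (D.Q₂ t)⁻¹ *ᵥ D.glued w t)

/-- Largest variance of the noise term. -/
noncomputable def noiseError (D : Data n m l) (w : Pieces n) : ℝ :=
  ∫ t in D.α..D.β, D.weight w t ⬝ᵥ (D.H t *ᵥ D.state w t)

/-! ### The energy identity and its consequences for the coupled system. -/

section Energy

variable (hD : D.Regular) (h : D.Propagates j w) (hb : D.BoundaryConditions w)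
include hD h hb

/-- The duality formula: with the boundary conditions on $z$, every boundary term of Green's
identity becomes a term in the data. The optimal weights and the constant are read off from it. -/
theorem dotProduct_eq_functional {f₀ : Fin m → ℝ} {f₁ : Fin (n - m) → ℝ}
    {f φ : ℝ → Fin n → ℝ}
    (hf : MemLp f 2 (volume.restrict (Ioo 0 D.T))) (hφ : D.SolvesBVP f₀ f₁ f φ) :
    j ⬝ᵥ φ D.s = D.functional w f₀ f₁ f + ∫ t in D.α..D.β, D.weight w t ⬝ᵥ (D.H t *ᵥ φ t) := by
  have g := h.green hD hf hφ.1
  rw [dotProduct_eq_barMatrix D.e₀ D.B₀ hD.det₀ hb.z₁_zero, hφ.2.1] at g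
  rw [dotProduct_eq_barMatrix D.e₁ D.B₁ hD.det₁ hb.z₄_end, hφ.2.2] at g
  simp only [functional, B₀bar, B₁bar]
  linarith

/-- The equations for $p$ make it the state generated by the extremal data of the functional; the
lower bound perturbs the centre in this direction. -/
theorem solvesBVP_state : D.SolvesBVP (D.Q₀⁻¹ *ᵥ (D.B₀bar *ᵥ w.z₁ 0))
    (-(D.Q₁⁻¹ *ᵥ (D.B₁bar *ᵥ w.z₄ D.T))) (fun t => (D.Q₂ t)⁻¹ *ᵥ D.glued w t) (D.state w) := by
  refine ⟨h.solvesDirect_state hD, ?_, ?_⟩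
  · rw [h.state_eqOn₁ hD ⟨le_rfl, hD.α_nonneg⟩, hb.p₁_zero]
  · rw [state_eqOn₄ hD w ⟨hD.β_le, le_rfl⟩, hb.p₄_end]

/-- The duality formula applied to the glued $p$ itself. -/
theorem energy : j ⬝ᵥ w.p₂ D.s = D.dataError w + D.noiseError w := by
  have := dotProduct_eq_functional hD h hb (h.memLp_Q₂_inv_glued hD) (solvesBVP_state hD h hb)
  rwa [h.state_eqOn₂ hD ⟨hD.s_mem.1.le, le_rfl⟩] at this

omit hD h hb in
theorem dataError_eq : D.dataError w
    = (D.Q₀⁻¹ *ᵥ (D.B₀bar *ᵥ w.z₁ 0)) ⬝ᵥ (D.B₀bar *ᵥ w.z₁ 0)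
      + (D.Q₁⁻¹ *ᵥ (D.B₁bar *ᵥ w.z₄ D.T)) ⬝ᵥ (D.B₁bar *ᵥ w.z₄ D.T)
      + ∫ t in (0 : ℝ)..D.T, ((D.Q₂ t)⁻¹ *ᵥ D.glued w t) ⬝ᵥ D.glued w t := by
  simp only [dataError, functional, dotProduct_neg, sub_neg_eq_add, dotProduct_comm]

omit h hb in
theorem dataError_nonneg : 0 ≤ D.dataError w := by
  rw [dataError_eq]
  have h1 := posDef_mulVec_dotProduct_nonneg hD.posDef_Q₀.inv (D.B₀bar *ᵥ w.z₁ 0)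
  have h2 := posDef_mulVec_dotProduct_nonneg hD.posDef_Q₁.inv (D.B₁bar *ᵥ w.z₄ D.T)
  have h3 := integral_posDef_nonneg (f := D.glued w) hD.T_nonneg fun t ht => (hD.posDef_Q₂ t ht).inv
  positivity

omit h hb in
theorem noiseError_nonneg : 0 ≤ D.noiseError w :=
  integral_posDef_nonneg hD.α_lt_β.le hD.posDef_Q

end Energy

/-- With zero jump the energy is zero, so its nonnegative data part vanishes. Positive definiteness
kills $z$ almost everywhere together with $\bar B_0z_1(0)$ and $\bar B_1z_4(T)$, and what remains
for $p$ is the homogeneous boundary value problem. -/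
theorem Propagates.eq_zero (hD : D.Regular) (h : D.Propagates 0 w) (hb : D.BoundaryConditions w) :
    ((∀ t ∈ Icc 0 D.α, w.z₁ t = 0) ∧ (∀ t ∈ Icc D.α D.s, w.z₂ t = 0) ∧
      (∀ t ∈ Icc D.s D.β, w.z₃ t = 0) ∧ (∀ t ∈ Icc D.β D.T, w.z₄ t = 0)) ∧
    ((∀ t ∈ Icc 0 D.α, w.p₁ t = 0) ∧ (∀ t ∈ Icc D.α D.s, w.p₂ t = 0) ∧
      (∀ t ∈ Icc D.s D.β, w.p₃ t = 0) ∧ (∀ t ∈ Icc D.β D.T, w.p₄ t = 0)) := by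
  have i1 := hD.α_nonneg
  have i2 := hD.s_mem.1
  have i3 := hD.s_mem.2
  have i4 := hD.β_le
  have hq : D.dataError w = 0 := by
    have := energy hD h hb
    rw [zero_dotProduct] at this
    linarith [dataError_nonneg (w := w) hD, noiseError_nonneg (w := w) hD]
  rw [dataError_eq] at hq
  have h1 := posDef_mulVec_dotProduct_nonneg hD.posDef_Q₀.inv (D.B₀bar *ᵥ w.z₁ 0)
  have h2 := posDef_mulVec_dotProduct_nonneg hD.posDef_Q₁.inv (D.B₁bar *ᵥ w.z₄ D.T)
  have h3 := integral_posDef_nonneg (f := D.glued w) hD.T_nonneg fun t ht => (hD.posDef_Q₂ t ht).inv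
  have z0 := posDef_eq_zero hD.posDef_Q₀.inv (x := D.B₀bar *ᵥ w.z₁ 0) (by linarith)
  have zT := posDef_eq_zero hD.posDef_Q₁.inv (x := D.B₁bar *ᵥ w.z₄ D.T) (by linarith)
  have hae := ae_eq_zero_of_posDef (f := D.glued w) hD.T_nonneg (fun t ht => (hD.posDef_Q₂ t ht).inv)
    (intervalIntegrable_dotProduct hD.T_nonneg (h.memLp_Q₂_inv_glued hD) (h.memLp_glued hD))
    (by linarith)
  have hsub : ∀ {x y : ℝ} {v : ℝ → Fin n → ℝ}, 0 ≤ x → y ≤ D.T → EqOn (D.glued w) v (Ioo x y) →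
      ∀ᵐ t ∂volume.restrict (Ioo x y), v t = 0 := fun {x y v} hx hy hv => by
    have : (volume : Measure ℝ).restrict (Ioo x y) ≤ volume.restrict (Ioo 0 D.T) :=
      Measure.restrict_mono (Ioo_subset_Ioo hx hy) le_rfl
    filter_upwards [ae_mono this hae, ae_restrict_mem measurableSet_Ioo] with t ht hm
    rw [← hv hm, ht]
  have Z2 := eqOn_zero_of_ae_Ioo i2 (h.z₂_eq.continuousOn i2.le)
    (hsub i1 (by linarith) (glued_eqOn₂ w))
  have Z3 := eqOn_zero_of_ae_Ioo i3 (h.z₃_eq.continuousOn i3.le)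
    (hsub (by linarith) i4 (glued_eqOn₃ hD w))
  have Z1 : ∀ t ∈ Icc 0 D.α, w.z₁ t = 0 := by
    -- On a one-point interval the almost-everywhere statement is void; the value comes from the
    -- matching condition.
    rcases eq_or_lt_of_le i1 with hα | hα
    · intro t ht
      have : t = D.α := by linarith [ht.1, ht.2]
      rw [this, ← h.z₂_left, Z2 _ ⟨le_rfl, i2.le⟩]
    · exact eqOn_zero_of_ae_Ioo hα (h.z₁_eq.continuousOn i1)
        (hsub le_rfl (by linarith) (glued_eqOn₁ w))
  have Z4 : ∀ t ∈ Icc D.β D.T, w.z₄ t = 0 := by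
    rcases eq_or_lt_of_le i4 with hβ | hβ
    · intro t ht
      have : t = D.β := by linarith [ht.1, ht.2]
      rw [this, h.z₄_left, Z3 _ ⟨i3.le, le_rfl⟩]
    · exact eqOn_zero_of_ae_Ioo hβ (h.z₄_eq.continuousOn i4)
        (hsub (by linarith) le_rfl (glued_eqOn₄ hD w))
  have hbvp := solvesBVP_state hD h hb
  rw [z0, zT] at hbvp
  have hP := hD.eq_zero_of_solvesBVP (D.state w) ⟨hbvp.1.congr hD.T_nonneg (fun _ _ => rfl) (by
    filter_upwards [hae] with t ht
    rw [ht, Matrix.mulVec_zero]), by simpa using hbvp.2.1, by simpa using hbvp.2.2⟩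
  refine ⟨⟨Z1, Z2, Z3, Z4⟩, fun t ht => ?_, fun t ht => ?_, fun t ht => ?_, fun t ht => ?_⟩
  · rw [← h.state_eqOn₁ hD ht, hP t ⟨ht.1, by linarith [ht.2]⟩]
  · rw [← h.state_eqOn₂ hD ht, hP t ⟨by linarith [ht.1], by linarith [ht.2]⟩]
  · rw [← h.state_eqOn₃ hD ht, hP t ⟨by linarith [ht.1], by linarith [ht.2]⟩]
  · rw [← state_eqOn₄ hD w ht, hP t ⟨by linarith [ht.1], by linarith [ht.2]⟩]

theorem BoundaryConditions.comb (k : ℝ) (h : D.BoundaryConditions w)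
    (h' : D.BoundaryConditions w') : D.BoundaryConditions (w.comb k w') := by
  refine ⟨?_, ?_, ?_, ?_⟩ <;>
  simp only [Pieces.comb, Matrix.mulVec_add, Matrix.mulVec_smul, h.z₁_zero, h.z₄_end, h.p₁_zero,
    h.p₄_end, h'.z₁_zero, h'.z₄_end, h'.p₁_zero, h'.p₄_end, smul_zero, add_zero, smul_neg, neg_add]

theorem agree_of_solvesSystem (hD : D.Regular) (h : D.SolvesSystem w) (h' : D.SolvesSystem w') :
    D.Agree w w' := by
  rw [solvesSystem_iff] at h h'
  have hp := h.1.comb hD (-1) h'.1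
  rw [neg_one_smul, neg_add_cancel] at hp
  obtain ⟨⟨a1, a2, a3, a4⟩, b1, b2, b3, b4⟩ := hp.eq_zero hD (h.2.comb (-1) h'.2)
  simp only [Pieces.comb, neg_one_smul, neg_add_eq_zero] at a1 a2 a3 a4 b1 b2 b3 b4
  exact ⟨⟨a1, a2, a3, a4⟩, b1, b2, b3, b4⟩

/-- Without conditions at $0$ and $T$ the system is an initial value problem, solved from left to
right through the nodes. -/
theorem exists_propagates (hD : D.Regular) (j v p : Fin n → ℝ) :
    ∃ w, D.Propagates j w ∧ w.z₁ 0 = v ∧ w.p₁ 0 = p := by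
  have i1 := hD.α_nonneg
  have i2 := hD.s_mem.1.le
  have i3 := hD.s_mem.2.le
  have i4 := hD.β_le
  have hA : ∀ {x y : ℝ}, 0 ≤ x → y ≤ D.T → ContinuousOn D.A (Icc x y) := fun hx hy =>
    hD.continuousOn_A.mono (Icc_subset_Icc hx hy)
  have hR : ∀ {x y : ℝ}, 0 ≤ x → y ≤ D.T → ContinuousOn (fun t => (D.Q₂ t)⁻¹) (Icc x y) :=
    fun hx hy => (continuousOn_Q₂_inv hD).mono (Icc_subset_Icc hx hy)
  have hG : ContinuousOn D.gram (Icc D.α D.β) := by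
    have h1 : ContinuousOn (fun t => D.Q t * D.H t) (Icc D.α D.β) :=
      (Continuous.matrix_mul continuous_fst continuous_snd).comp_continuousOn
        (hD.continuousOn_Q.prodMk hD.continuousOn_H)
    have h2 : ContinuousOn (fun t => (D.H t)ᵀ) (Icc D.α D.β) :=
      (Continuous.matrix_transpose continuous_id).comp_continuousOn hD.continuousOn_H
    exact (Continuous.matrix_mul continuous_fst continuous_snd).comp_continuousOn (h2.prodMk h1)
  have h0 : ∀ {S : Set ℝ}, ContinuousOn (fun _ : ℝ => (0 : Matrix (Fin n) (Fin n) ℝ)) S :=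
    continuousOn_const
  obtain ⟨z₁, p₁, a1, b1, c1, d1⟩ := exists_solves_coupled i1 (hA le_rfl (by linarith)) h0
    (hR le_rfl (by linarith)) v p
  obtain ⟨z₂, p₂, a2, b2, c2, d2⟩ := exists_solves_coupled i2 (hA i1 (by linarith))
    (hG.mono (Icc_subset_Icc_right i3)) (hR i1 (by linarith)) (z₁ D.α) (p₁ D.α)
  obtain ⟨z₃, p₃, a3, b3, c3, d3⟩ := exists_solves_coupled i3 (hA (by linarith) i4)
    (hG.mono (Icc_subset_Icc_left i2)) (hR (by linarith) i4) (z₂ D.s - j) (p₂ D.s)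
  obtain ⟨z₄, p₄, a4, b4, c4, d4⟩ := exists_solves_coupled i4 (hA (by linarith) le_rfl) h0
    (hR (by linarith) le_rfl) (z₃ D.β) (p₃ D.β)
  simp only [Matrix.zero_mulVec, neg_zero] at a1 a4
  exact ⟨⟨z₁, z₂, z₃, z₄, p₁, p₂, p₃, p₄⟩, ⟨a1, a2, c2, a3, c3, a4, c4, b1, b2, d2, b3, d3, b4, d4⟩,
    c1, d1⟩

/-- The free parameters are the jump and the values of $z$ and $p$ at $0$, in all $3n$. The
conditions are the prescribed jump and the $2n$ boundary residuals `res`. Counting the jump on both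
sides makes the relation linear, and `Propagates.eq_zero` is its injectivity. -/
theorem exists_solvesSystem (hD : D.Regular) : ∃ w, D.SolvesSystem w := by
  have hmn : m + (n - m) = n := by simpa using Fintype.card_congr D.e₀
  let res (w : Pieces n) : ((Fin (n - m) → ℝ) × (Fin m → ℝ)) × ((Fin m → ℝ) × (Fin (n - m) → ℝ)) :=
    ((D.B₀hat *ᵥ w.z₁ 0, D.B₁hat *ᵥ w.z₄ D.T),
      (D.B₀ *ᵥ w.p₁ 0 - D.Q₀⁻¹ *ᵥ (D.B₀bar *ᵥ w.z₁ 0),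
        D.B₁ *ᵥ w.p₄ D.T + D.Q₁⁻¹ *ᵥ (D.B₁bar *ᵥ w.z₄ D.T)))
  have hres : ∀ k w w', res (w.comb k w') = k • res w + res w' := by
    intro k w w'
    simp only [res, Pieces.comb, Matrix.mulVec_add, Matrix.mulVec_smul, Prod.smul_mk, Prod.mk_add_mk,
      smul_sub, smul_add, Prod.mk.injEq, true_and]
    exact ⟨by abel, by abel⟩
  have hb : ∀ {w}, res w = 0 → D.BoundaryConditions w := by
    intro w hw
    simp only [res, Prod.mk_eq_zero] at hw
    exact ⟨hw.1.1, hw.1.2, sub_eq_zero.1 hw.2.1, eq_neg_of_add_eq_zero_left hw.2.2⟩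
  obtain ⟨w₀, hw₀, hz₀, hp₀⟩ := exists_propagates hD 0 0 0
  obtain ⟨⟨j, v, p⟩, w, hw, -, -, hj, hr⟩ := exists_left_of_linear_relation
    (E := (Fin n → ℝ) × (Fin n → ℝ) × (Fin n → ℝ))
    (F := (Fin n → ℝ) × ((Fin (n - m) → ℝ) × (Fin m → ℝ)) × ((Fin m → ℝ) × (Fin (n - m) → ℝ)))
    (by simp; omega)
    {x | ∃ w, D.Propagates x.1.1 w ∧ w.z₁ 0 = x.1.2.1 ∧ w.p₁ 0 = x.1.2.2 ∧ x.2.1 = x.1.1 ∧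
      x.2.2 = res w}
    (by
      refine ⟨w₀.comb (-1) w₀, ?_, ?_, ?_, rfl, ?_⟩
      · simpa using hw₀.comb hD (-1) hw₀
      · simp [Pieces.comb]
      · simp [Pieces.comb]
      · rw [hres]; simp)
    (by
      rintro k ⟨⟨j, v, p⟩, f⟩ ⟨⟨j', v', p'⟩, f'⟩ ⟨w, h1, h2, h3, h4, h5⟩ ⟨w', h1', h2', h3', h4', h5'⟩
      refine ⟨w.comb k w', h1.comb hD k h1', ?_, ?_, ?_, ?_⟩
      · simp [Pieces.comb, h2, h2']
      · simp [Pieces.comb, h3, h3']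
      · simp only at h4 h4'
        simp [h4, h4']
      · simp only at h5 h5'
        simp [h5, h5', hres])
    (by
      rintro ⟨j, v, p⟩
      obtain ⟨w, hw, h1, h2⟩ := exists_propagates hD j v p
      exact ⟨(j, res w), w, hw, h1, h2, rfl, rfl⟩)
    (by
      rintro ⟨j, v, p⟩ ⟨w, hw, h1, h2, h3, h4⟩
      simp only [Prod.fst_zero, Prod.snd_zero] at h1 h2 h3 h4
      subst h3
      obtain ⟨⟨a1, -⟩, b1, -⟩ := Propagates.eq_zero hD hw (hb h4.symm)
      rw [← h1, ← h2, a1 0 ⟨le_rfl, hD.α_nonneg⟩, b1 0 ⟨le_rfl, hD.α_nonneg⟩]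
      rfl)
    (D.a, 0)
  simp only at hj hr hw
  subst hj
  exact ⟨w, solvesSystem_iff.2 ⟨hw, hb hr.symm⟩⟩

end Data

end TwoPoint

namespace TwoPoint

/-! ### Quadratic forms and Cauchy–Schwarz. -/

section Quadratic

variable {k : Type*} [Fintype k]

theorem posDef_quadratic_sub {M : Matrix k k ℝ} (hM : M.PosDef) (θ : ℝ) (x y : k → ℝ) :
    (M *ᵥ (x - θ • y)) ⬝ᵥ (x - θ • y)
      = (M *ᵥ x) ⬝ᵥ x - 2 * θ * ((M *ᵥ y) ⬝ᵥ x) + θ ^ 2 * ((M *ᵥ y) ⬝ᵥ y) := by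
  have h1 : (M *ᵥ x) ⬝ᵥ y = (M *ᵥ y) ⬝ᵥ x := by rw [posDef_symm hM, dotProduct_comm]
  simp only [Matrix.mulVec_sub, Matrix.mulVec_smul, sub_dotProduct, dotProduct_sub, smul_dotProduct,
    dotProduct_smul, smul_eq_mul, h1]
  ring

theorem integral_quadratic_sub {M : ℝ → Matrix k k ℝ} {a b : ℝ} (hab : a ≤ b)
    (hM : ContinuousOn M (Icc a b)) (hpos : ∀ t ∈ Icc a b, (M t).PosDef) (θ : ℝ) {f g : ℝ → k → ℝ}
    (hf : MemLp f 2 (volume.restrict (Ioo a b))) (hg : MemLp g 2 (volume.restrict (Ioo a b))) :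
    ∫ t in a..b, (M t *ᵥ (f t - θ • g t)) ⬝ᵥ (f t - θ • g t)
      = (∫ t in a..b, (M t *ᵥ f t) ⬝ᵥ f t) - 2 * θ * (∫ t in a..b, (M t *ᵥ g t) ⬝ᵥ f t)
        + θ ^ 2 * ∫ t in a..b, (M t *ᵥ g t) ⬝ᵥ g t := by
  have h1 := intervalIntegrable_dotProduct hab (memLp_mulVec hM hf) hf
  have h2 := intervalIntegrable_dotProduct hab (memLp_mulVec hM hg) hf
  have h3 := intervalIntegrable_dotProduct hab (memLp_mulVec hM hg) hg
  rw [← intervalIntegral.integral_const_mul, ← intervalIntegral.integral_const_mul,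
    ← intervalIntegral.integral_sub h1 (h2.const_mul _),
    ← intervalIntegral.integral_add (h1.sub (h2.const_mul _)) (h3.const_mul _)]
  exact integral_congr_ae_Ioo hab (ae_Ioo_of_forall fun t ht =>
    posDef_quadratic_sub (hpos t (Ioo_subset_Icc_self ht)) θ _ _)

/-- A quadratic polynomial in $\theta$ that is never negative has nonpositive discriminant; no case
distinction for $c=0$ is needed. -/
theorem sq_le_mul_of_forall_nonneg {a b c : ℝ} (h : ∀ θ : ℝ, 0 ≤ a - 2 * θ * b + θ ^ 2 * c) :
    b ^ 2 ≤ c * a := by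
  have := discrim_le_zero (a := c) (b := -2 * b) (c := a) fun θ => by
    have := h θ
    nlinarith
  rw [discrim] at this
  linarith

theorem integral_cauchy_schwarz {M : ℝ → Matrix k k ℝ} {a b : ℝ} (hab : a ≤ b)
    (hM : ContinuousOn M (Icc a b)) (hpos : ∀ t ∈ Icc a b, (M t).PosDef) {f g : ℝ → k → ℝ}
    (hf : MemLp f 2 (volume.restrict (Ioo a b))) (hg : MemLp g 2 (volume.restrict (Ioo a b))) :
    (∫ t in a..b, (M t *ᵥ g t) ⬝ᵥ f t) ^ 2
      ≤ (∫ t in a..b, (M t *ᵥ g t) ⬝ᵥ g t) * ∫ t in a..b, (M t *ᵥ f t) ⬝ᵥ f t := by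
  refine sq_le_mul_of_forall_nonneg fun θ => ?_
  rw [← integral_quadratic_sub hab hM hpos θ hf hg]
  exact integral_posDef_nonneg hab hpos

end Quadratic

/-! ### Centred noise: second moments and Fubini arguments. -/

section Noise

variable {Ω : Type*} [MeasurableSpace Ω] {P : Measure Ω} [IsProbabilityMeasure P]

/-- Bias–variance decomposition: the cross term vanishes since $N$ is centred. -/
theorem lintegral_sub_sq {N : Ω → ℝ} (hN : MemLp N 2 P) (h0 : ∫ ω, N ω ∂P = 0) (x : ℝ) :
    ∫⁻ ω, ENNReal.ofReal ((x - N ω) ^ 2) ∂P = ENNReal.ofReal (x ^ 2 + ∫ ω, N ω ^ 2 ∂P) := by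
  have h1 : MemLp (fun ω => x - N ω) 2 P := (memLp_const x).sub hN
  rw [← ofReal_integral_eq_lintegral_ofReal h1.integrable_sq
    (Filter.Eventually.of_forall fun ω => sq_nonneg _)]
  congr 1
  have hi := hN.integrable (by norm_num)
  have : ∀ ω, (x - N ω) ^ 2 = x ^ 2 - 2 * x * N ω + N ω ^ 2 := fun ω => by ring
  simp only [this]
  have e1 : ∫ ω, (x ^ 2 - 2 * x * N ω) ∂P = x ^ 2 := by
    rw [integral_sub (integrable_const _) (hi.const_mul _), integral_const_mul, h0]
    simp
  have e2 := integral_add (f := fun ω => x ^ 2 - 2 * x * N ω)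
    ((integrable_const (x ^ 2)).sub (hi.const_mul (2 * x))) hN.integrable_sq
  rw [e2, e1]

/-- On a nontrivial probability space there is a bounded centred random variable of variance one. -/
theorem exists_standardized (hP : ∃ E : Set Ω, MeasurableSet E ∧ P E ≠ 0 ∧ P E ≠ 1) :
    ∃ η : Ω → ℝ, Measurable η ∧ (∃ K : ℝ, ∀ ω, ‖η ω‖ ≤ K) ∧ ∫ ω, η ω ∂P = 0 ∧
      ∫ ω, η ω ^ 2 ∂P = 1 := by
  obtain ⟨E, hE, h0, h1⟩ := hP
  set p := P.real E with hp
  have hp0 : 0 < p := ENNReal.toReal_pos h0 (measure_ne_top _ _)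
  have hp1 : p < 1 := by
    rw [hp, Measure.real, ← ENNReal.toReal_one]
    exact (ENNReal.toReal_lt_toReal (measure_ne_top _ _) ENNReal.one_ne_top).2
      (lt_of_le_of_ne prob_le_one h1)
  -- The indicator of $E$ has mean $p$ and variance $p(1-p)>0$; it is centred and then rescaled by
  -- `κ`.
  set κ := (Real.sqrt (p * (1 - p)))⁻¹
  have hκ : κ ^ 2 * (p * (1 - p)) = 1 := by
    have hpos : 0 < p * (1 - p) := mul_pos hp0 (by linarith)
    rw [inv_pow, Real.sq_sqrt hpos.le, inv_mul_cancel₀ hpos.ne']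
  have hI : Integrable (E.indicator fun _ => (1 : ℝ)) P := (integrable_const _).indicator hE
  have hIv : ∫ ω, E.indicator (fun _ => (1 : ℝ)) ω ∂P = p := by
    rw [integral_indicator_const _ hE]; simp [hp]
  refine ⟨fun ω => κ * (E.indicator (fun _ => 1) ω - p), ?_, ⟨‖κ‖ * (1 + ‖p‖), fun ω => ?_⟩, ?_, ?_⟩
  · exact ((measurable_const.indicator hE).sub measurable_const).const_mul κ
  · rw [norm_mul]
    gcongr
    refine (norm_sub_le _ _).trans ?_
    gcongr
    refine (norm_indicator_le_norm_self _ _).trans ?_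
    simp
  · rw [integral_const_mul, integral_sub hI (integrable_const _), hIv]; simp
  · have : ∀ ω, (κ * (E.indicator (fun _ => (1 : ℝ)) ω - p)) ^ 2
        = κ ^ 2 * ((1 - 2 * p) * E.indicator (fun _ => (1 : ℝ)) ω + p ^ 2) := by
      intro ω
      by_cases h : ω ∈ E
      · simp only [indicator_of_mem h]; ring
      · simp only [indicator_of_notMem h]; ring
    simp only [this]
    rw [integral_const_mul, integral_add (hI.const_mul _) (integrable_const _), integral_const_mul,
      hIv]
    simp only [integral_const, probReal_univ, smul_eq_mul, one_mul]
    linear_combination hκ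

variable {l : ℕ}

omit [IsProbabilityMeasure P] in
theorem trace_mul_correlation (Q : Matrix (Fin l) (Fin l) ℝ) (ξ : ℝ → Ω → Fin l → ℝ) (t : ℝ)
    (hξ : MemLp (ξ t) 2 P) :
    (Q * Data.correlation P ξ t t).trace = ∫ ω, (Q *ᵥ ξ t ω) ⬝ᵥ ξ t ω ∂P := by
  have hi : ∀ i j, Integrable (fun ω => ξ t ω j * ξ t ω i) P := fun i j =>
    (hξ.eval j).integrable_mul (hξ.eval i)
  simp only [Matrix.trace, Matrix.diag, Matrix.mul_apply, Data.correlation, Matrix.of_apply,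
    dotProduct, Matrix.mulVec, Finset.sum_mul, mul_assoc]
  have h1 : ∀ i, ∫ ω, ∑ j, Q i j * (ξ t ω j * ξ t ω i) ∂P
      = ∑ j, Q i j * ∫ ω, ξ t ω j * ξ t ω i ∂P := fun i => by
    rw [integral_finsetSum _ fun j _ => (hi i j).const_mul _]
    simp only [integral_const_mul]
  have h2 := integral_finsetSum (μ := P) (Finset.univ : Finset (Fin l))
    (f := fun i ω => ∑ j, Q i j * (ξ t ω j * ξ t ω i))
    fun i _ => integrable_finsetSum _ fun j _ => (hi i j).const_mul _
  refine Eq.trans ?_ h2.symm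
  refine Finset.sum_congr rfl fun i _ => ((h1 i).trans ?_).symm
  rfl

namespace Data

variable {n m : ℕ} {D : Data n m l} {ξ : ℝ → Ω → Fin l → ℝ}

/-- Joint measurability and integrability of $M|\xi(t)|^2$ give square integrability on the product
space. This licenses every interchange of expectation and time integral below. -/
theorem InV.memLp_prod (hξ : D.InV P ξ) :
    MemLp (Function.uncurry ξ) 2 ((volume.restrict (Ioo D.α D.β)).prod P) := by
  have hm := hξ.1
  have hdm : Measurable fun q : ℝ × Ω => Function.uncurry ξ q ⬝ᵥ Function.uncurry ξ q :=
    Finset.measurable_sum _ fun i _ =>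
      ((measurable_pi_apply i).comp hm).mul ((measurable_pi_apply i).comp hm)
  have hnn : ∀ x : Fin l → ℝ, 0 ≤ x ⬝ᵥ x := fun x => Finset.sum_nonneg fun i _ => mul_self_nonneg _
  have hi : Integrable (fun q : ℝ × Ω => Function.uncurry ξ q ⬝ᵥ Function.uncurry ξ q)
      ((volume.restrict (Ioo D.α D.β)).prod P) := by
    rw [integrable_prod_iff hdm.aestronglyMeasurable]
    refine ⟨ae_Ioo_of_forall fun t ht =>
      integrable_dotProduct (hξ.2.1 t ht).1 (hξ.2.1 t ht).1, ?_⟩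
    simp only [Real.norm_of_nonneg (hnn _)]
    exact hξ.2.2.1
  refine memLp_pi_iff.2 fun i => ?_
  have hmi : AEStronglyMeasurable (fun q : ℝ × Ω => Function.uncurry ξ q i)
      ((volume.restrict (Ioo D.α D.β)).prod P) :=
    ((measurable_pi_apply i).comp hm).aestronglyMeasurable
  rw [memLp_two_iff_integrable_sq hmi]
  refine hi.mono (hmi.pow 2) (Filter.Eventually.of_forall fun q => ?_)
  rw [Real.norm_of_nonneg (sq_nonneg _), Real.norm_of_nonneg (hnn _), sq]
  exact Finset.single_le_sum (f := fun i => Function.uncurry ξ q i * Function.uncurry ξ q i)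
    (fun i _ => mul_self_nonneg _) (Finset.mem_univ i)

theorem InV.ae_memLp (hξ : D.InV P ξ) :
    ∀ᵐ ω ∂P, MemLp (fun t => ξ t ω) 2 (volume.restrict (Ioo D.α D.β)) := by
  have h : ∀ i, ∀ᵐ ω ∂P, MemLp (fun t => ξ t ω i) 2 (volume.restrict (Ioo D.α D.β)) := fun i => by
    have := (hξ.memLp_prod.eval i).integrable_sq.prod_left_ae
    filter_upwards [this] with ω hω
    refine (memLp_two_iff_integrable_sq ?_).2 hω
    have hm : Measurable fun t => ξ t ω i :=
      (measurable_pi_apply i).comp (hξ.1.comp measurable_prodMk_right)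
    exact hm.aestronglyMeasurable
  filter_upwards [ae_all_iff.2 h] with ω hω using memLp_pi_iff.2 hω

/-- Fubini turns the trace constraint on the correlation matrix into a bound on the mean of a
pathwise quadratic form, to which pathwise Cauchy–Schwarz can be applied. -/
theorem InV.integral_quadratic (hD : D.Regular) (hξ : D.InV P ξ) :
    Integrable (fun ω => ∫ t in D.α..D.β, (D.Q t *ᵥ ξ t ω) ⬝ᵥ ξ t ω) P ∧
      ∫ ω, (∫ t in D.α..D.β, (D.Q t *ᵥ ξ t ω) ⬝ᵥ ξ t ω) ∂P ≤ 1 := by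
  have hab := hD.α_lt_β.le
  have hQξ : MemLp (fun q : ℝ × Ω => D.Q q.1 *ᵥ Function.uncurry ξ q) 2
      ((volume.restrict (Ioo D.α D.β)).prod P) := by
    refine memLp_mulVec_of_bound (fun i j => ?_) (fun i j => ?_) hξ.memLp_prod
    · exact (hD.continuousOn_Q.aestronglyMeasurable_entry i j).comp_fst
    · obtain ⟨K, hK⟩ := hD.continuousOn_Q.exists_bound_entry i j
      exact ⟨K, Measure.quasiMeasurePreserving_fst.ae hK⟩
  have hi := integrable_dotProduct hQξ hξ.memLp_prod
  simp only [integral_eq_integral_Ioo hab]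
  refine ⟨hi.integral_prod_right, ?_⟩
  rw [← integral_integral_swap hi]
  refine le_trans (le_of_eq ?_) hξ.2.2.2
  rw [integral_eq_integral_Ioo hab]
  refine setIntegral_congr_fun measurableSet_Ioo fun t ht => ?_
  exact (trace_mul_correlation _ _ _ (hξ.2.1 t ht).1).symm

theorem InV.noise (hD : D.Regular) (hξ : D.InV P ξ) {u : ℝ → Fin l → ℝ}
    (hu : MemLp u 2 (volume.restrict (Ioo D.α D.β))) :
    Integrable (fun ω => ∫ t in D.α..D.β, u t ⬝ᵥ ξ t ω) P ∧
      ∫ ω, (∫ t in D.α..D.β, u t ⬝ᵥ ξ t ω) ∂P = 0 := by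
  have hab := hD.α_lt_β.le
  have hi := integrable_dotProduct (hu.comp_fst P) hξ.memLp_prod
  simp only [integral_eq_integral_Ioo hab]
  refine ⟨hi.integral_prod_right, ?_⟩
  rw [← integral_integral_swap hi]
  refine integral_eq_zero_of_ae (ae_Ioo_of_forall fun t ht => ?_)
  have hξt := (hξ.2.1 t ht).1.integrable (by norm_num)
  simp only [Pi.zero_apply, dotProduct]
  rw [integral_finsetSum _ fun i _ => (hξt.eval i).const_mul _]
  refine Finset.sum_eq_zero fun i _ => ?_
  rw [integral_const_mul, ← eval_integral fun i => hξt.eval i, (hξ.2.1 t ht).2]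
  simp

end Data

end Noise

end TwoPoint

/-! ### Bounds for the worst mean square error. -/

namespace TwoPoint

namespace Data

variable {n m l : ℕ} {D : Data n m l} {w : Pieces n}
  {Ω : Type*} [MeasurableSpace Ω] {P : Measure Ω} [IsProbabilityMeasure P]

/-- The quadratic form of the ellipsoid of the data. -/
noncomputable def dataNorm (D : Data n m l) (g₀ : Fin m → ℝ) (g₁ : Fin (n - m) → ℝ)
    (g : ℝ → Fin n → ℝ) : ℝ :=
  (D.Q₀ *ᵥ g₀) ⬝ᵥ g₀ + (D.Q₁ *ᵥ g₁) ⬝ᵥ g₁ + ∫ t in (0 : ℝ)..D.T, (D.Q₂ t *ᵥ g t) ⬝ᵥ g t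

theorem dataNorm_nonneg (hD : D.Regular) (g₀ : Fin m → ℝ) (g₁ : Fin (n - m) → ℝ)
    (g : ℝ → Fin n → ℝ) : 0 ≤ D.dataNorm g₀ g₁ g := by
  have h1 := posDef_mulVec_dotProduct_nonneg hD.posDef_Q₀ g₀
  have h2 := posDef_mulVec_dotProduct_nonneg hD.posDef_Q₁ g₁
  have h3 := integral_posDef_nonneg (f := g) hD.T_nonneg hD.posDef_Q₂
  simp only [dataNorm]
  positivity

section Data

variable (hD : D.Regular) {j : Fin n → ℝ} (h : D.Propagates j w)
include hD h

/-- This is the Riesz representation in expanded form: the cross term is the functional, and the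
squared norm of the representative is `dataError`. -/
theorem dataNorm_sub (θ : ℝ) (g₀ : Fin m → ℝ) (g₁ : Fin (n - m) → ℝ)
    {g : ℝ → Fin n → ℝ} (hg : MemLp g 2 (volume.restrict (Ioo 0 D.T))) :
    D.dataNorm (g₀ - θ • (D.Q₀⁻¹ *ᵥ (D.B₀bar *ᵥ w.z₁ 0)))
      (g₁ - θ • (-(D.Q₁⁻¹ *ᵥ (D.B₁bar *ᵥ w.z₄ D.T))))
      (fun t => g t - θ • ((D.Q₂ t)⁻¹ *ᵥ D.glued w t))
      = D.dataNorm g₀ g₁ g - 2 * θ * D.functional w g₀ g₁ g + θ ^ 2 * D.dataError w := by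
  have hi : ∀ φ : ℝ → Fin n → ℝ, ∫ t in (0 : ℝ)..D.T, (D.Q₂ t *ᵥ ((D.Q₂ t)⁻¹ *ᵥ D.glued w t)) ⬝ᵥ φ t
      = ∫ t in (0 : ℝ)..D.T, D.glued w t ⬝ᵥ φ t := fun φ =>
    integral_congr_ae_Ioo hD.T_nonneg (ae_Ioo_of_forall fun t ht => by
      rw [mulVec_inv_mulVec (hD.posDef_Q₂ t (Ioo_subset_Icc_self ht))])
  have h1 := posDef_quadratic_sub hD.posDef_Q₀ θ g₀ (D.Q₀⁻¹ *ᵥ (D.B₀bar *ᵥ w.z₁ 0))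
  have h2 := posDef_quadratic_sub hD.posDef_Q₁ θ g₁ (-(D.Q₁⁻¹ *ᵥ (D.B₁bar *ᵥ w.z₄ D.T)))
  have h3 := integral_quadratic_sub hD.T_nonneg hD.continuousOn_Q₂ hD.posDef_Q₂ θ hg
    (h.memLp_Q₂_inv_glued hD)
  rw [mulVec_inv_mulVec hD.posDef_Q₀] at h1
  rw [Matrix.mulVec_neg, mulVec_inv_mulVec hD.posDef_Q₁, neg_dotProduct, neg_dotProduct,
    dotProduct_neg] at h2
  rw [hi, hi] at h3
  simp only [dataNorm, dataError, functional, dotProduct_neg]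
  rw [h1, h2, h3]
  ring

theorem functional_sq_le (g₀ : Fin m → ℝ) (g₁ : Fin (n - m) → ℝ)
    {g : ℝ → Fin n → ℝ} (hg : MemLp g 2 (volume.restrict (Ioo 0 D.T))) :
    D.functional w g₀ g₁ g ^ 2 ≤ D.dataError w * D.dataNorm g₀ g₁ g := by
  refine sq_le_mul_of_forall_nonneg fun θ => ?_
  rw [← dataNorm_sub hD h θ g₀ g₁ hg]
  exact dataNorm_nonneg hD _ _ _

/-- The representative has squared norm `dataError`, so shifting the centre by $\theta$ times it
costs exactly $\theta^2$ times that number. -/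
theorem inG_add_smul {θ : ℝ} (hθ : θ ^ 2 * D.dataError w ≤ 1) :
    D.InG (D.f₀c + θ • (D.Q₀⁻¹ *ᵥ (D.B₀bar *ᵥ w.z₁ 0)))
      (D.f₁c + θ • (-(D.Q₁⁻¹ *ᵥ (D.B₁bar *ᵥ w.z₄ D.T))))
      (fun t => D.fc t + θ • ((D.Q₂ t)⁻¹ *ᵥ D.glued w t)) := by
  refine ⟨hD.memLp_fc.add ((h.memLp_Q₂_inv_glued hD).const_smul θ), ?_⟩
  have := dataNorm_sub hD h (-θ) 0 0 (g := fun _ => 0) MemLp.zero'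
  simp only [zero_sub, neg_smul, neg_neg] at this
  simp only [dataNorm] at this
  simp only [add_sub_cancel_left]
  rw [this]
  simpa [functional] using hθ

theorem functional_sub (f₀ g₀ : Fin m → ℝ) (f₁ g₁ : Fin (n - m) → ℝ)
    {f g : ℝ → Fin n → ℝ} (hf : MemLp f 2 (volume.restrict (Ioo 0 D.T)))
    (hg : MemLp g 2 (volume.restrict (Ioo 0 D.T))) :
    D.functional w (f₀ - g₀) (f₁ - g₁) (fun t => f t - g t)
      = D.functional w f₀ f₁ f - D.functional w g₀ g₁ g := by
  simp only [functional, dotProduct_sub]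
  rw [intervalIntegral.integral_sub
    (intervalIntegrable_dotProduct hD.T_nonneg (h.memLp_glued hD) hf)
    (intervalIntegrable_dotProduct hD.T_nonneg (h.memLp_glued hD) hg)]
  ring

end Data

theorem memLp_observation (hD : D.Regular) {f₀ : Fin m → ℝ} {f₁ : Fin (n - m) → ℝ}
    {f φ : ℝ → Fin n → ℝ} (hφ : D.SolvesBVP f₀ f₁ f φ) :
    MemLp (fun t => D.H t *ᵥ φ t) 2 (volume.restrict (Ioo D.α D.β)) :=
  (continuousOn_mulVec hD.continuousOn_H
    ((hφ.1.continuousOn hD.T_nonneg).mono hD.Icc_subset)).memLp_two_Ioo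

theorem SolvesBVP.add_smul (hD : D.Regular) {f₀ g₀ : Fin m → ℝ} {f₁ g₁ : Fin (n - m) → ℝ}
    {f g φ ψ : ℝ → Fin n → ℝ} (hφ : D.SolvesBVP f₀ f₁ f φ) (hψ : D.SolvesBVP g₀ g₁ g ψ) (θ : ℝ) :
    D.SolvesBVP (f₀ + θ • g₀) (f₁ + θ • g₁) (fun t => f t + θ • g t) (fun t => φ t + θ • ψ t) := by
  refine ⟨?_, ?_, ?_⟩
  · have := hψ.1.linear_comb hD.T_nonneg θ hφ.1
    simpa only [add_comm] using this
  · rw [Matrix.mulVec_add, Matrix.mulVec_smul, hφ.2.1, hψ.2.1]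
  · rw [Matrix.mulVec_add, Matrix.mulVec_smul, hφ.2.2, hψ.2.2]

/-- An estimate in terms of a single weight on `(α, β)`. -/
theorem estimate_eq (hD : D.Regular) {u₁ u₂ u y : ℝ → Fin l → ℝ} (c : ℝ)
    (hu : MemLp u 2 (volume.restrict (Ioo D.α D.β))) (hy : MemLp y 2 (volume.restrict (Ioo D.α D.β)))
    (h₁ : u₁ =ᵐ[volume.restrict (Ioo D.α D.s)] u) (h₂ : u₂ =ᵐ[volume.restrict (Ioo D.s D.β)] u) :
    D.estimate u₁ u₂ c y = (∫ t in D.α..D.β, u t ⬝ᵥ y t) + c := by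
  have i2 := hD.s_mem.1.le
  have i3 := hD.s_mem.2.le
  have hi := intervalIntegrable_dotProduct hD.α_lt_β.le hu hy
  have e₁ : ∫ t in D.α..D.s, u₁ t ⬝ᵥ y t = ∫ t in D.α..D.s, u t ⬝ᵥ y t :=
    integral_congr_ae_Ioo i2 (by filter_upwards [h₁] with t ht; rw [ht])
  have e₂ : ∫ t in D.s..D.β, u₂ t ⬝ᵥ y t = ∫ t in D.s..D.β, u t ⬝ᵥ y t :=
    integral_congr_ae_Ioo i3 (by filter_upwards [h₂] with t ht; rw [ht])
  rw [estimate, e₁, e₂, intervalIntegral.integral_add_adjacent_intervals]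
  · refine hi.mono_set ?_
    rw [uIcc_of_le i2, uIcc_of_le hD.α_lt_β.le]; exact Icc_subset_Icc_right i3
  · refine hi.mono_set ?_
    rw [uIcc_of_le i3, uIcc_of_le hD.α_lt_β.le]; exact Icc_subset_Icc_left i2

/-- The estimation error splits into a deterministic part and a noise part. -/
theorem error_eq (hD : D.Regular) {u₁ u₂ u y η : ℝ → Fin l → ℝ} (x c : ℝ)
    (hu : MemLp u 2 (volume.restrict (Ioo D.α D.β))) (hy : MemLp y 2 (volume.restrict (Ioo D.α D.β)))
    (hη : MemLp η 2 (volume.restrict (Ioo D.α D.β)))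
    (h₁ : u₁ =ᵐ[volume.restrict (Ioo D.α D.s)] u) (h₂ : u₂ =ᵐ[volume.restrict (Ioo D.s D.β)] u) :
    x - D.estimate u₁ u₂ c (fun t => y t + η t)
      = (x - (∫ t in D.α..D.β, u t ⬝ᵥ y t) - c) - ∫ t in D.α..D.β, u t ⬝ᵥ η t := by
  rw [estimate_eq hD c hu (y := fun t => y t + η t) (hy.add hη) h₁ h₂]
  simp only [dotProduct_add]
  rw [intervalIntegral.integral_add (intervalIntegrable_dotProduct hD.α_lt_β.le hu hy)
    (intervalIntegrable_dotProduct hD.α_lt_β.le hu hη)]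
  ring

theorem weight_ae_eq (hD : D.Regular) {j : Fin n → ℝ} (h : D.Propagates j w) :
    D.uHat₁ w =ᵐ[volume.restrict (Ioo D.α D.s)] D.weight w ∧
      D.uHat₂ w =ᵐ[volume.restrict (Ioo D.s D.β)] D.weight w :=
  ⟨ae_Ioo_of_forall fun t ht => by
      rw [uHat₁, weight, h.state_eqOn₂ hD (Ioo_subset_Icc_self ht)],
    ae_Ioo_of_forall fun t ht => by
      rw [uHat₂, weight, h.state_eqOn₃ hD (Ioo_subset_Icc_self ht)]⟩

/-- Since the weight is $Q$ applied to $Hp$, Cauchy–Schwarz in the $Q$-inner product bounds the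
squared noise term path by path; taking expectations uses the constraint defining $V$. -/
theorem noise_variance_le (hD : D.Regular) {j : Fin n → ℝ} (h : D.Propagates j w)
    {ξ : ℝ → Ω → Fin l → ℝ} (hξ : D.InV P ξ) :
    MemLp (fun ω => ∫ t in D.α..D.β, D.weight w t ⬝ᵥ ξ t ω) 2 P ∧
      ∫ ω, (∫ t in D.α..D.β, D.weight w t ⬝ᵥ ξ t ω) ^ 2 ∂P ≤ D.noiseError w := by
  have hN := hξ.noise hD (h.continuousOn_weight hD).memLp_two_Ioo
  obtain ⟨hS, hS1⟩ := hξ.integral_quadratic hD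
  have hle : ∀ᵐ ω ∂P, (∫ t in D.α..D.β, D.weight w t ⬝ᵥ ξ t ω) ^ 2
      ≤ D.noiseError w * ∫ t in D.α..D.β, (D.Q t *ᵥ ξ t ω) ⬝ᵥ ξ t ω := by
    filter_upwards [hξ.ae_memLp] with ω hω
    exact integral_cauchy_schwarz hD.α_lt_β.le hD.continuousOn_Q hD.posDef_Q hω
      (h.continuousOn_observed hD).memLp_two_Ioo
  have hsq : Integrable (fun ω => (∫ t in D.α..D.β, D.weight w t ⬝ᵥ ξ t ω) ^ 2) P := by
    refine (hS.const_mul (D.noiseError w)).mono' (hN.1.aestronglyMeasurable.pow 2) ?_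
    filter_upwards [hle] with ω hω
    rwa [Real.norm_of_nonneg (sq_nonneg _)]
  refine ⟨(memLp_two_iff_integrable_sq hN.1.aestronglyMeasurable).2 hsq, ?_⟩
  refine (integral_mono_ae hsq (hS.const_mul _) hle).trans ?_
  rw [integral_const_mul]
  exact mul_le_of_le_one_right (noiseError_nonneg hD) hS1

/-- By the duality formula and the choice of `cHat`, the bias is the functional at the deviation of
the data from the centre. Bias and variance are then bounded separately. -/
theorem worstError_le (hD : D.Regular) {j : Fin n → ℝ} (ha : D.a = j) (h : D.Propagates j w)
    (hb : D.BoundaryConditions w) :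
    D.worstError P (D.uHat₁ w) (D.uHat₂ w) (D.cHat w)
      ≤ ENNReal.ofReal (D.dataError w + D.noiseError w) := by
  refine iSup_le fun f₀ => iSup_le fun f₁ => iSup_le fun f => iSup_le fun hG => iSup_le fun φ =>
    iSup_le fun hφ => iSup_le fun ξ => iSup_le fun hξ => ?_
  have hw := (h.continuousOn_weight hD).memLp_two_Ioo
  obtain ⟨hN2, hNr⟩ := noise_variance_le hD h hξ
  obtain ⟨-, hN0⟩ := hξ.noise hD hw
  set x := D.functional w (f₀ - D.f₀c) (f₁ - D.f₁c) (fun t => f t - D.fc t) with hx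
  have hdet : D.a ⬝ᵥ φ D.s - (∫ t in D.α..D.β, D.weight w t ⬝ᵥ (D.H t *ᵥ φ t)) - D.cHat w = x := by
    rw [ha, dotProduct_eq_functional hD h hb hG.1 hφ, hx, functional_sub hD h _ _ _ _ hG.1 hD.memLp_fc]
    simp only [cHat, functional]
    ring
  have hcongr : ∀ᵐ ω ∂P, ENNReal.ofReal ((D.a ⬝ᵥ φ D.s - D.estimate (D.uHat₁ w) (D.uHat₂ w)
      (D.cHat w) (fun t => D.H t *ᵥ φ t + ξ t ω)) ^ 2)
      = ENNReal.ofReal ((x - ∫ t in D.α..D.β, D.weight w t ⬝ᵥ ξ t ω) ^ 2) := by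
    filter_upwards [hξ.ae_memLp] with ω hω
    rw [error_eq hD _ _ hw (memLp_observation hD hφ) hω (weight_ae_eq hD h).1 (weight_ae_eq hD h).2,
      hdet]
  rw [lintegral_congr_ae hcongr, lintegral_sub_sq hN2 hN0]
  refine ENNReal.ofReal_le_ofReal (add_le_add ?_ hNr)
  refine (functional_sq_le hD h _ _ (hG.1.sub hD.memLp_fc)).trans ?_
  exact mul_le_of_le_one_right (dataError_nonneg hD) hG.2

/-- For every weight there is an admissible noise of largest variance. -/
theorem exists_noise (hD : D.Regular) (hP : ∃ E : Set Ω, MeasurableSet E ∧ P E ≠ 0 ∧ P E ≠ 1)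
    {u : ℝ → Fin l → ℝ} (hu : MemLp u 2 (volume.restrict (Ioo D.α D.β))) :
    ∃ ξ : ℝ → Ω → Fin l → ℝ, D.InV P ξ ∧
      (∀ ω, MemLp (fun t => ξ t ω) 2 (volume.restrict (Ioo D.α D.β))) ∧
      ∀ x : ℝ, ∫⁻ ω, ENNReal.ofReal ((x - ∫ t in D.α..D.β, u t ⬝ᵥ ξ t ω) ^ 2) ∂P
        = ENNReal.ofReal (x ^ 2 + ∫ t in D.α..D.β, ((D.Q t)⁻¹ *ᵥ u t) ⬝ᵥ u t) := by
  have hab := hD.α_lt_β.le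
  obtain ⟨η, hηm, ⟨K, hK⟩, hη0, hη1⟩ := exists_standardized hP
  have hη2 : MemLp η 2 P := MemLp.of_bound hηm.aestronglyMeasurable K (Filter.Eventually.of_forall hK)
  have hQu : MemLp (fun t => (D.Q t)⁻¹ *ᵥ u t) 2 (volume.restrict (Ioo D.α D.β)) :=
    memLp_mulVec (continuousOn_matrix_inv hD.continuousOn_Q hD.posDef_Q) hu
  -- A Borel representative of $Q^{-1}u$ is taken because membership in $V$ requires joint
  -- measurability.
  set g := hQu.aestronglyMeasurable.mk
  have hgm : Measurable g := hQu.aestronglyMeasurable.stronglyMeasurable_mk.measurable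
  have hge : (fun t => (D.Q t)⁻¹ *ᵥ u t) =ᵐ[volume.restrict (Ioo D.α D.β)] g :=
    hQu.aestronglyMeasurable.ae_eq_mk
  have hg : MemLp g 2 (volume.restrict (Ioo D.α D.β)) := hQu.ae_eq hge
  set ρ := ∫ t in D.α..D.β, ((D.Q t)⁻¹ *ᵥ u t) ⬝ᵥ u t with hρ
  have hρ0 : 0 ≤ ρ := integral_posDef_nonneg hab fun t ht => (hD.posDef_Q t ht).inv
  have hug : ∫ t in D.α..D.β, u t ⬝ᵥ g t = ρ := integral_congr_ae_Ioo hab (by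
    filter_upwards [hge] with t ht
    rw [← ht, dotProduct_comm])
  have hQg : ∫ t in D.α..D.β, (D.Q t *ᵥ g t) ⬝ᵥ g t = ρ := integral_congr_ae_Ioo hab (by
    filter_upwards [hge, ae_restrict_mem measurableSet_Ioo] with t ht hm
    rw [← ht, mulVec_inv_mulVec (hD.posDef_Q t (Ioo_subset_Icc_self hm)), dotProduct_comm])
  -- The process $k\eta g$ spends $k^2\rho$ of the noise budget, and its integral against $u$ has
  -- variance $k^2\rho^2$. So $k=\rho^{-1/2}$ uses the budget exactly, and $k=0$ serves when
  -- $\rho=0$.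
  obtain ⟨k, hk1, hk2⟩ : ∃ k : ℝ, k ^ 2 * ρ ≤ 1 ∧ k ^ 2 * ρ ^ 2 = ρ := by
    rcases eq_or_lt_of_le hρ0 with h0 | h0
    · exact ⟨0, by simp, by rw [← h0]; ring⟩
    · refine ⟨(Real.sqrt ρ)⁻¹, ?_, ?_⟩ <;> rw [inv_pow, Real.sq_sqrt hρ0]
      · rw [inv_mul_cancel₀ h0.ne']
      · field_simp
  have hsq : ∀ (M : Matrix (Fin l) (Fin l) ℝ) (x : Fin l → ℝ),
      ∫ ω, (M *ᵥ ((k * η ω) • x)) ⬝ᵥ ((k * η ω) • x) ∂P = k ^ 2 * ((M *ᵥ x) ⬝ᵥ x) := fun M x => by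
    have : ∀ ω, (M *ᵥ ((k * η ω) • x)) ⬝ᵥ ((k * η ω) • x) = (k ^ 2 * ((M *ᵥ x) ⬝ᵥ x)) * η ω ^ 2 := by
      intro ω
      simp only [Matrix.mulVec_smul, smul_dotProduct, dotProduct_smul, smul_eq_mul]
      ring
    simp only [this]
    rw [integral_const_mul, hη1, mul_one]
  have hξ2 : ∀ t, MemLp (fun ω => (k * η ω) • g t) 2 P := fun t =>
    memLp_pi_iff.2 fun i => (hη2.const_mul k).mul_const (g t i)
  refine ⟨fun t ω => (k * η ω) • g t, ⟨?_, fun t _ => ⟨hξ2 t, ?_⟩, ?_, ?_⟩, fun ω =>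
    hg.const_smul (k * η ω), fun x => ?_⟩
  · exact ((hηm.const_mul k).comp measurable_snd).smul (hgm.comp measurable_fst)
  · rw [integral_smul_const, integral_const_mul, hη0, mul_zero, zero_smul]
  · have : ∀ t, ∫ ω, ((k * η ω) • g t) ⬝ᵥ ((k * η ω) • g t) ∂P = k ^ 2 * (g t ⬝ᵥ g t) := fun t => by
      simpa using hsq 1 (g t)
    simp only [this]
    exact (integrable_dotProduct hg hg).const_mul _
  · have : ∀ t, (D.Q t * correlation P (fun t ω => (k * η ω) • g t) t t).trace
        = k ^ 2 * ((D.Q t *ᵥ g t) ⬝ᵥ g t) := fun t => by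
      rw [trace_mul_correlation _ _ _ (hξ2 t), hsq]
    simp only [this]
    rw [intervalIntegral.integral_const_mul, hQg]
    exact hk1
  · have hN : ∀ ω, ∫ t in D.α..D.β, u t ⬝ᵥ ((k * η ω) • g t) = k * ρ * η ω := fun ω => by
      simp only [dotProduct_smul, smul_eq_mul]
      rw [intervalIntegral.integral_const_mul, hug]
      ring
    simp only [hN]
    rw [lintegral_sub_sq (hη2.const_mul _) (by rw [integral_const_mul, hη0, mul_zero])]
    simp only [mul_pow]
    rw [integral_const_mul, hη1, mul_one, hk2]

/-- For $q>0$ take $\theta=\pm q^{-1/2}$ with the sign that makes the cross term with $d$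
nonnegative; then $\theta^2(q-b)^2=q-2b+b^2/q$. For $q=0$ the constraint on $\theta$ is void, and
$\theta^2=2/|b|$ compensates a negative $b$. -/
theorem exists_scaling {q : ℝ} (hq : 0 ≤ q) (d b : ℝ) :
    ∃ θ : ℝ, θ ^ 2 * q ≤ 1 ∧ d ^ 2 + q ≤ (d + θ * (q - b)) ^ 2 + 2 * b := by
  have key : ∃ κ : ℝ, 0 ≤ κ ∧ κ ^ 2 * q ≤ 1 ∧ q ≤ κ ^ 2 * (q - b) ^ 2 + 2 * b := by
    rcases eq_or_lt_of_le hq with h | h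
    · subst h
      by_cases hb : b = 0
      · exact ⟨0, le_rfl, by simp, by simp [hb]⟩
      · refine ⟨Real.sqrt (2 / |b|), Real.sqrt_nonneg _, by simp, ?_⟩
        rw [Real.sq_sqrt (by positivity), zero_sub, neg_sq, ← sq_abs b]
        have hb' : |b| ≠ 0 := abs_ne_zero.2 hb
        have : 2 / |b| * |b| ^ 2 = 2 * |b| := by field_simp
        rw [this]
        linarith [neg_abs_le b]
    · refine ⟨(Real.sqrt q)⁻¹, by positivity, ?_, ?_⟩ <;> rw [inv_pow, Real.sq_sqrt hq]
      · rw [inv_mul_cancel₀ h.ne']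
      · have : q⁻¹ * (q - b) ^ 2 = q - 2 * b + q⁻¹ * b ^ 2 := by field_simp; ring
        rw [this]
        have : 0 ≤ q⁻¹ * b ^ 2 := by positivity
        linarith
  obtain ⟨κ, hκ0, hκ1, hκ2⟩ := key
  rcases le_total 0 (d * (q - b)) with h | h
  · exact ⟨κ, hκ1, by nlinarith [mul_nonneg hκ0 h]⟩
  · exact ⟨-κ, by rwa [neg_sq], by nlinarith [mul_nonneg hκ0 (neg_nonneg.2 h)]⟩

/-- Lower bound for the largest mean square error of an arbitrary linear estimate. -/
theorem le_worstError (hD : D.Regular) (hP : ∃ E : Set Ω, MeasurableSet E ∧ P E ≠ 0 ∧ P E ≠ 1)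
    (h : D.Propagates D.a w) (hb : D.BoundaryConditions w) {φ : ℝ → Fin n → ℝ}
    (hφ : D.SolvesBVP D.f₀c D.f₁c D.fc φ) {u₁ u₂ u : ℝ → Fin l → ℝ} (c : ℝ)
    (hu : MemLp u 2 (volume.restrict (Ioo D.α D.β)))
    (h₁ : u₁ =ᵐ[volume.restrict (Ioo D.α D.s)] u) (h₂ : u₂ =ᵐ[volume.restrict (Ioo D.s D.β)] u) :
    ENNReal.ofReal (D.dataError w + D.noiseError w
      + (∫ t in D.α..D.β, ((D.Q t)⁻¹ *ᵥ (u t - D.weight w t)) ⬝ᵥ (u t - D.weight w t))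
      + (D.a ⬝ᵥ φ D.s - (∫ t in D.α..D.β, u t ⬝ᵥ (D.H t *ᵥ φ t)) - c) ^ 2)
      ≤ D.worstError P u₁ u₂ c := by
  have hab := hD.α_lt_β.le
  obtain ⟨ξ, hξ, hξ2, hξN⟩ := exists_noise hD hP hu
  -- `d` is the bias at the centre of the ellipsoid, and `e` measures the response of $u$ to the
  -- extremal state.
  set d := D.a ⬝ᵥ φ D.s - (∫ t in D.α..D.β, u t ⬝ᵥ (D.H t *ᵥ φ t)) - c
  set e := ∫ t in D.α..D.β, u t ⬝ᵥ (D.H t *ᵥ D.state w t) with he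
  have hwt := (h.continuousOn_weight hD).memLp_two_Ioo
  have hob := (h.continuousOn_observed hD).memLp_two_Ioo
  have hcong : ∀ v : ℝ → Fin l → ℝ, ∫ t in D.α..D.β, ((D.Q t)⁻¹ *ᵥ D.weight w t) ⬝ᵥ v t
      = ∫ t in D.α..D.β, v t ⬝ᵥ (D.H t *ᵥ D.state w t) := fun v =>
    integral_congr_ae_Ioo hab (ae_Ioo_of_forall fun t ht => by
      rw [weight, inv_mulVec_mulVec (hD.posDef_Q t (Ioo_subset_Icc_self ht)), dotProduct_comm])
  -- Completing the square: the noise variance, the $Q^{-1}$-norm squared of $u$, equals that of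
  -- $u-QHp$ plus $2e-\nu$ with $\nu$ the noise error.
  have hquad := integral_quadratic_sub hab (continuousOn_matrix_inv hD.continuousOn_Q hD.posDef_Q)
    (fun t ht => (hD.posDef_Q t ht).inv) 1 hu hwt
  simp only [one_smul] at hquad
  rw [hcong, hcong, ← he] at hquad
  -- With $b=e-\nu$ the bias at the shifted data is $d+\theta(q-b)$, and the leftover $2e-\nu$ is
  -- $2b+\nu$. The scaling inequality therefore yields $d^2+q+\nu$ and the square.
  obtain ⟨θ, hθ1, hθ2⟩ := exists_scaling (dataError_nonneg (w := w) hD) d (e - D.noiseError w)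
  have hsolve := SolvesBVP.add_smul hD hφ (solvesBVP_state hD h hb) θ
  have hlow : ∫⁻ ω, ENNReal.ofReal ((D.a ⬝ᵥ (φ D.s + θ • D.state w D.s) - D.estimate u₁ u₂ c
      (fun t => D.H t *ᵥ (φ t + θ • D.state w t) + ξ t ω)) ^ 2) ∂P ≤ D.worstError P u₁ u₂ c :=
    le_iSup_of_le _ <| le_iSup_of_le _ <| le_iSup_of_le _ <| le_iSup_of_le (inG_add_smul hD h hθ1) <|
      le_iSup_of_le _ <| le_iSup_of_le hsolve <| le_iSup_of_le ξ <| le_iSup_of_le hξ le_rfl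
  refine le_trans ?_ hlow
  have hs : D.a ⬝ᵥ D.state w D.s = D.dataError w + D.noiseError w := by
    rw [h.state_eqOn₂ hD ⟨hD.s_mem.1.le, le_rfl⟩, energy hD h hb]
  have hdet : D.a ⬝ᵥ (φ D.s + θ • D.state w D.s)
      - (∫ t in D.α..D.β, u t ⬝ᵥ (D.H t *ᵥ (φ t + θ • D.state w t))) - c
      = d + θ * (D.dataError w - (e - D.noiseError w)) := by
    simp only [Matrix.mulVec_add, Matrix.mulVec_smul, dotProduct_add, dotProduct_smul, smul_eq_mul]
    rw [intervalIntegral.integral_add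
      (intervalIntegrable_dotProduct hab hu (memLp_observation hD hφ))
      ((intervalIntegrable_dotProduct hab hu hob).const_mul θ),
      intervalIntegral.integral_const_mul, hs]
    ring
  have herr : ∀ ω, D.a ⬝ᵥ (φ D.s + θ • D.state w D.s) - D.estimate u₁ u₂ c
      (fun t => D.H t *ᵥ (φ t + θ • D.state w t) + ξ t ω)
      = (d + θ * (D.dataError w - (e - D.noiseError w))) - ∫ t in D.α..D.β, u t ⬝ᵥ ξ t ω := fun ω => by
    rw [error_eq hD _ _ hu (memLp_observation hD hsolve) (hξ2 ω) h₁ h₂, hdet]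
  simp only [herr, hξN]
  refine ENNReal.ofReal_le_ofReal ?_
  have hnoise : D.noiseError w = ∫ t in D.α..D.β, D.weight w t ⬝ᵥ (D.H t *ᵥ D.state w t) := rfl
  rw [← hnoise] at hquad
  linarith

omit [IsProbabilityMeasure P] in
theorem worstError_congr {u₁ u₂ v₁ v₂ : ℝ → Fin l → ℝ} (hD : D.Regular) (c : ℝ)
    (h₁ : u₁ =ᵐ[volume.restrict (Ioo D.α D.s)] v₁) (h₂ : u₂ =ᵐ[volume.restrict (Ioo D.s D.β)] v₂) :
    D.worstError P u₁ u₂ c = D.worstError P v₁ v₂ c := by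
  have : ∀ y, D.estimate u₁ u₂ c y = D.estimate v₁ v₂ c y := fun y => by
    rw [estimate, estimate, integral_congr_ae_Ioo hD.s_mem.1.le (g := fun t => v₁ t ⬝ᵥ y t),
      integral_congr_ae_Ioo hD.s_mem.2.le (g := fun t => v₂ t ⬝ᵥ y t)]
    · filter_upwards [h₂] with t ht
      rw [ht]
    · filter_upwards [h₁] with t ht
      rw [ht]
  simp only [worstError, this]

theorem exists_merged {u₁ u₂ : ℝ → Fin l → ℝ} (hu : D.Admissible u₁ u₂) :
    ∃ u, MemLp u 2 (volume.restrict (Ioo D.α D.β)) ∧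
      u₁ =ᵐ[volume.restrict (Ioo D.α D.s)] u ∧ u₂ =ᵐ[volume.restrict (Ioo D.s D.β)] u := by
  have e1 : u₁ =ᵐ[volume.restrict (Ioo D.α D.s)] fun t => if t < D.s then u₁ t else u₂ t :=
    ae_Ioo_of_forall fun t ht => (if_pos ht.2).symm
  have e2 : u₂ =ᵐ[volume.restrict (Ioo D.s D.β)] fun t => if t < D.s then u₁ t else u₂ t :=
    ae_Ioo_of_forall fun t ht => (if_neg (not_lt.2 ht.1.le)).symm
  exact ⟨_, memLp_Ioo_glue (hu.1.ae_eq e1) (hu.2.ae_eq e2), e1, e2⟩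

/-! ### The minimax value and the uniqueness of the minimax estimate. -/

section Minimax

variable (hD : D.Regular) (hP : ∃ E : Set Ω, MeasurableSet E ∧ P E ≠ 0 ∧ P E ≠ 1)
  (h : D.Propagates D.a w) (hb : D.BoundaryConditions w)
include hD h

theorem admissible_hat : D.Admissible (D.uHat₁ w) (D.uHat₂ w) := by
  have hwt := (h.continuousOn_weight hD).memLp_two_Ioo
  exact ⟨(hwt.mono_measure (Measure.restrict_mono (Ioo_subset_Ioo_right hD.s_mem.2.le) le_rfl)).ae_eq
    (weight_ae_eq hD h).1.symm,
    (hwt.mono_measure (Measure.restrict_mono (Ioo_subset_Ioo_left hD.s_mem.1.le) le_rfl)).ae_eq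
    (weight_ae_eq hD h).2.symm⟩

include hP hb

theorem minimaxValue_eq : D.minimaxValue P = ENNReal.ofReal (D.dataError w + D.noiseError w) := by
  refine le_antisymm ?_ ?_
  · exact iInf_le_of_le _ <| iInf_le_of_le _ <| iInf_le_of_le (admissible_hat hD h) <|
      iInf_le_of_le _ (worstError_le hD rfl h hb)
  · refine le_iInf fun u₁ => le_iInf fun u₂ => le_iInf fun hu => le_iInf fun c => ?_
    obtain ⟨u, hu2, h₁, h₂⟩ := exists_merged hu
    obtain ⟨φ, hφ⟩ := hD.exists_solvesBVP D.f₀c D.f₁c hD.memLp_fc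
    refine le_trans (ENNReal.ofReal_le_ofReal ?_) (le_worstError hD hP h hb hφ c hu2 h₁ h₂)
    have := integral_posDef_nonneg (f := fun t => u t - D.weight w t) hD.α_lt_β.le
      fun t ht => (hD.posDef_Q t ht).inv
    rw [add_assoc]
    exact le_add_of_nonneg_right (add_nonneg this (sq_nonneg _))

/-- Equality in the lower bound forces both surplus terms to vanish. The $Q^{-1}$-norm gives the
weights almost everywhere; with these weights, zero bias at the centre is exactly the formula for
the constant. -/
theorem isMinimax_iff (u₁ u₂ : ℝ → Fin l → ℝ) (c : ℝ) : D.IsMinimax P u₁ u₂ c ↔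
    u₁ =ᵐ[volume.restrict (Ioo D.α D.s)] D.uHat₁ w ∧
      u₂ =ᵐ[volume.restrict (Ioo D.s D.β)] D.uHat₂ w ∧ c = D.cHat w := by
  have hval := minimaxValue_eq hD hP h hb
  have hab := hD.α_lt_β.le
  obtain ⟨φ, hφ⟩ := hD.exists_solvesBVP D.f₀c D.f₁c hD.memLp_fc
  constructor
  · rintro ⟨hu, hmin⟩
    obtain ⟨u, hu2, h₁, h₂⟩ := exists_merged hu
    have hle := le_worstError hD hP h hb hφ c hu2 h₁ h₂
    rw [hmin, hval, ENNReal.ofReal_le_ofReal_iff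
      (add_nonneg (dataError_nonneg hD) (noiseError_nonneg hD))] at hle
    have hpos := integral_posDef_nonneg (f := fun t => u t - D.weight w t) hab
      fun t ht => (hD.posDef_Q t ht).inv
    have hv2 : MemLp (fun t => u t - D.weight w t) 2 (volume.restrict (Ioo D.α D.β)) :=
      hu2.sub (h.continuousOn_weight hD).memLp_two_Ioo
    have hv := ae_eq_zero_of_posDef (f := fun t => u t - D.weight w t) hab
      (fun t ht => (hD.posDef_Q t ht).inv)
      (intervalIntegrable_dotProduct hab
        (memLp_mulVec (continuousOn_matrix_inv hD.continuousOn_Q hD.posDef_Q) hv2) hv2)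
      (by nlinarith [sq_nonneg (D.a ⬝ᵥ φ D.s - (∫ t in D.α..D.β, u t ⬝ᵥ (D.H t *ᵥ φ t)) - c)])
    have hd : D.a ⬝ᵥ φ D.s - (∫ t in D.α..D.β, u t ⬝ᵥ (D.H t *ᵥ φ t)) - c = 0 :=
      pow_eq_zero_iff two_ne_zero |>.1 (le_antisymm (by linarith) (sq_nonneg _))
    rw [integral_congr_ae_Ioo hab (g := fun t => D.weight w t ⬝ᵥ (D.H t *ᵥ φ t)) (by
      filter_upwards [hv] with t ht
      rw [sub_eq_zero.1 ht]), dotProduct_eq_functional hD h hb hD.memLp_fc hφ] at hd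
    refine ⟨?_, ?_, ?_⟩
    · have := ae_mono (Measure.restrict_mono (Ioo_subset_Ioo_right hD.s_mem.2.le) le_rfl) hv
      filter_upwards [this, h₁, (weight_ae_eq hD h).1] with t e1 e2 e3
      rw [e2, e3, sub_eq_zero.1 e1]
    · have := ae_mono (Measure.restrict_mono (Ioo_subset_Ioo_left hD.s_mem.1.le) le_rfl) hv
      filter_upwards [this, h₂, (weight_ae_eq hD h).2] with t e1 e2 e3
      rw [e2, e3, sub_eq_zero.1 e1]
    · simp only [functional] at hd
      simp only [cHat]
      linarith
  · rintro ⟨h₁, h₂, rfl⟩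
    have hadm := admissible_hat hD h
    refine ⟨⟨hadm.1.ae_eq h₁.symm, hadm.2.ae_eq h₂.symm⟩, ?_⟩
    rw [worstError_congr hD _ h₁ h₂]
    refine le_antisymm (hval ▸ worstError_le hD rfl h hb) ?_
    exact iInf_le_of_le _ <| iInf_le_of_le _ <| iInf_le_of_le hadm <| iInf_le_of_le _ le_rfl

end Minimax

end Data

end TwoPoint

theorem theorem3p1 {n m l : ℕ} (D : TwoPoint.Data n m l)
    {Ω : Type*} [MeasurableSpace Ω] (P : Measure Ω) [IsProbabilityMeasure P]
    -- the probability space is not trivial, so that there are non-degenerate noises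
    (hP : ∃ E : Set Ω, MeasurableSet E ∧ P E ≠ 0 ∧ P E ≠ 1)
    (hα : 0 ≤ D.α) (hs : D.s ∈ Ioo D.α D.β) (hβ : D.β ≤ D.T)
    (hA : ContinuousOn D.A (Icc 0 D.T))
    (hH : ContinuousOn D.H (Icc D.α D.β))
    -- the selected square submatrices of the boundary matrices are nondegenerate
    (hB₀ : (TwoPoint.selectedCols D.e₀ D.B₀).det ≠ 0)
    (hB₁ : (TwoPoint.selectedCols D.e₁ D.B₁).det ≠ 0)
    -- the homogeneous boundary value problem has only the trivial solution
    (hhom : ∀ φ : ℝ → Fin n → ℝ, D.SolvesBVP 0 0 (fun _ => 0) φ → ∀ t ∈ Icc 0 D.T, φ t = 0)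
    (hQ : ContinuousOn D.Q (Icc D.α D.β)) (hQpos : ∀ t ∈ Icc D.α D.β, (D.Q t).PosDef)
    (hQ₀ : D.Q₀.PosDef) (hQ₁ : D.Q₁.PosDef)
    (hQ₂ : ContinuousOn D.Q₂ (Icc 0 D.T)) (hQ₂pos : ∀ t ∈ Icc 0 D.T, (D.Q₂ t).PosDef)
    (hfc : MemLp D.fc 2 (volume.restrict (Ioo 0 D.T))) :
    -- the system is uniquely solvable
    (∃ w : TwoPoint.Pieces n, D.SolvesSystem w) ∧
    (∀ w w' : TwoPoint.Pieces n, D.SolvesSystem w → D.SolvesSystem w' → D.Agree w w') ∧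
    -- its solution gives the minimax estimate, which is unique, and the minimax error
    ∀ w : TwoPoint.Pieces n, D.SolvesSystem w →
      (∀ (u₁ u₂ : ℝ → Fin l → ℝ) (c : ℝ), D.IsMinimax P u₁ u₂ c ↔
        u₁ =ᵐ[volume.restrict (Ioo D.α D.s)] D.uHat₁ w ∧
        u₂ =ᵐ[volume.restrict (Ioo D.s D.β)] D.uHat₂ w ∧
        c = D.cHat w) ∧
      0 ≤ D.a ⬝ᵥ w.p₂ D.s ∧
      D.minimaxError P = ENNReal.ofReal (Real.sqrt (D.a ⬝ᵥ w.p₂ D.s)) := by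
  have hD : D.Regular := ⟨hα, hs, hβ, hA, hH, hB₀, hB₁, hhom, hQ, hQpos, hQ₀, hQ₁, hQ₂, hQ₂pos, hfc⟩
  refine ⟨TwoPoint.Data.exists_solvesSystem hD,
    fun w w' h h' => TwoPoint.Data.agree_of_solvesSystem hD h h', fun w hw => ?_⟩
  obtain ⟨h, hb⟩ := TwoPoint.Data.solvesSystem_iff.1 hw
  have h0 : 0 ≤ D.a ⬝ᵥ w.p₂ D.s := by
    rw [TwoPoint.Data.energy hD h hb]
    exact add_nonneg (TwoPoint.Data.dataError_nonneg hD) (TwoPoint.Data.noiseError_nonneg hD)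
  refine ⟨TwoPoint.Data.isMinimax_iff hD hP h hb, h0, ?_⟩
  rw [TwoPoint.Data.minimaxError, TwoPoint.Data.minimaxValue_eq hD hP h hb,
    ← TwoPoint.Data.energy hD h hb, ENNReal.ofReal_rpow_of_nonneg h0 (by norm_num),
    Real.sqrt_eq_rpow]
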